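/- Let $p$ be a prime, $e\ge 1$ an integer, and $V$ an integral Noetherian scheme of characteristic $p$ that is $F$-finite and $F$-pure. Let $f\colon X\to V$ be a morphism of finite type and $L$ a line bundle on $X$. Write $R=\mathcal O_X$, $A=f^{-1}\mathcal O_V$, let $(-)^{1/p^k}=F^k_*(-)$ denote pushforward under the $k$-th iterate of the absolute Frobenius, put $V^{k}=V$ viewed as a $V$-scheme through $F^k\colon V\to V$, and $X_{V^{k}}=X\times_V V^{k}$, so that $\mathcal O_{X_{V^{k}}}=R_{A^{1/p^k}}:=R\otimes_A A^{1/p^k}$. Fix an $R_{A^{1/p^e}}$-linear map $\phi\colon L^{1/p^e}\to R_{A^{1/p^e}}$. *Iterates.* Define $\phi^n\colon \big(L^{\frac{p^{ne}-1}{p^e-1}}\big)^{1/p^{ne}}\to R_{A^{1/p^{ne}}}$ by letting $\phi^0$ be the identity of $R$ and $\phi^{n}$ the composition of $$(L\otimes_R\phi^{n-1})^{1/p^e}\colon \big(L^{\frac{p^{ne}-1}{p^e-1}}\big)^{1/p^{ne}}\to (L\otimes_R R_{A^{1/p^{(n-1)e}}})^{1/p^e}=L^{1/p^e}\otimes_{A^{1/p^e}}A^{1/p^{ne}}$$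 with $\phi\otimes_{A^{1/p^e}}A^{1/p^{ne}}$, and let $\sigma_n(X/V,\phi)\subseteq\mathcal O_{X_{V^{ne}}}$ be the image of $\phi^n$. For a scheme $Y$ of characteristic $p$, a line bundle $N$ on $Y$ and an $\mathcal O_Y$-linear map $\psi\colon F^e_*N\to\mathcal O_Y$, the iterates are $\psi^0=\mathrm{id}$ and $\psi^{n}=\psi\circ F^e_*(N\otimes\psi^{n-1})$, and the absolute non-$F$-pure ideal $\sigma(Y,\psi)$ is the intersection $\bigcap_n\operatorname{Im}(\psi^n)$ of the descending chain of their images (its stable value, when the chain stabilizes). *Perfect points.* A perfect point $u$ of $V$ is a morphism $\operatorname{Spec}K\to V$ with $K$ a perfect field. The base change $\phi_u$ of $\phi$ to $X_u=X\times_V u$, a map $L_u^{1/p^e}\to \mathcal O_{X_u}\otimes_K K^{1/p^e}$, is identified through $K^{1/p^e}\cong K$ with an absolute map $\psi_u\colon F^e_*L_u\to\mathcal O_{X_u}$. Let $\psi_\infty$ be this map for $K=k(V)^{1/p^\infty}$, the perfection of the function field of $V$, and let $n_0$ be an integer such that the images of the iterates satisfy $\operatorname{Im}(\psi_\infty^n)=\operatorname{Im}(\psi_\infty^{n_0})$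 for all $n\ge n_0$. *The induced absolute map.* Let $M$ be a line bundle on $V$ and $\Psi\colon F^e_*M\to\mathcal O_V$ an $\mathcal O_V$-linear map that generates $\mathcal Hom_{\mathcal O_V}(F^e_*M,\mathcal O_V)$ as an $F^e_*\mathcal O_V$-module (for instance $V$ quasi-Gorenstein and $M=\omega_V^{1-p^e}=\mathcal O_V((1-p^e)K_V)$ with its standard generator). For an integer $n$ put $N=L\otimes_A M^{1/p^{ne}}$, a line bundle on $X_{V^{ne}}$, and let $$\gamma\colon N^{1/p^e}=L^{1/p^e}\otimes_{A^{1/p^e}}M^{1/p^{(n+1)e}}\to R\otimes_A M^{1/p^{(n+1)e}}\to R\otimes_A A^{1/p^{ne}}=\mathcal O_{X_{V^{ne}}}$$ be the composition of $\phi\otimes_{A^{1/p^e}} M^{1/p^{(n+1)e}}$ and $R\otimes_A\Psi^{1/p^{ne}}$. **Theorem.** For every $n>n_0$ there is a dense open subset $U\subseteq V$ such that, with $W=f^{-1}(U)$, $$\sigma(X_{V^{ne}},\gamma)|_W=\sigma_n(X/V,\phi)|_W,$$ and such that for every perfect point $u\in U$ (that is, $\operatorname{Spec}K\to V$ with image in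 $U$) $$\sigma(X_{V^{ne}},\gamma)\cdot\mathcal O_{X_u}=\sigma_n(X_u/u,\phi_u)=\sigma(X_u,\psi_u),$$ where $X_{u^{ne}}=X\times_V \operatorname{Spec}K^{1/p^{ne}}$ is identified with $X_u$ through $K\cong K^{1/p^{ne}}$. -/

import Mathlib

open CategoryTheory AlgebraicGeometry TopologicalSpace
open scoped TensorProduct

universe u

noncomputable section

namespace RelFrob

/-! ### Rings of characteristic `p` and Frobenius pushforwards -/

/-- `A` is an algebra over `𝔽_p`, i.e. `p = 0` in `A` (the zero ring is allowed, since it may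
occur as the ring of functions of an empty fibre). -/
class InCharP (p : ℕ) (A : Type*) [CommRing A] : Prop where
  cast_eq_zero : (p : A) = 0

theorem add_pow_prime_pow {p : ℕ} [Fact p.Prime] {A : Type*} [CommRing A] [InCharP p A]
    (k : ℕ) (a b : A) : (a + b) ^ p ^ k = a ^ p ^ k + b ^ p ^ k := by
  rcases subsingleton_or_nontrivial A with h | h
  · exact Subsingleton.elim _ _
  · have : CharP A p := by
      have h1 := (CharP.cast_eq_zero_iff A (ringChar A) p).1 InCharP.cast_eq_zero
      rcases (Nat.dvd_prime (Fact.out : p.Prime)).1 h1 with h2 | h2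
      · exact absurd h2 (CharP.ringChar_ne_one)
      · exact h2 ▸ ringChar.charP A
    exact add_pow_char_pow a b p k

/-- The `k`-fold iterate of the Frobenius endomorphism, `a ↦ a ^ (p ^ k)`. -/
def iterFrob (p k : ℕ) [Fact p.Prime] (A : Type*) [CommRing A] [InCharP p A] : A →+* A where
  toFun a := a ^ p ^ k
  map_one' := one_pow _
  map_mul' a b := mul_pow a b _
  map_zero' := zero_pow (pow_ne_zero _ (Fact.out : p.Prime).ne_zero)
  map_add' := add_pow_prime_pow k

@[simp]
theorem iterFrob_apply (p k : ℕ) [Fact p.Prime] {A : Type*} [CommRing A] [InCharP p A] (a : A) :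
    iterFrob p k A a = a ^ p ^ k := rfl

instance {p : ℕ} {A R B : Type*} [CommRing A] [CommRing R] [CommRing B] [Algebra A R]
    [Algebra A B] [InCharP p R] : InCharP p (R ⊗[A] B) where
  cast_eq_zero := by
    have h := congrArg (algebraMap R (R ⊗[A] B)) (InCharP.cast_eq_zero (p := p) (A := R))
    simpa using h

instance (priority := 50) {p : ℕ} {A : Type*} [CommRing A] [CharP A p] : InCharP p A where
  cast_eq_zero := CharP.cast_eq_zero A p

/-- The Frobenius pushforward `P^{1/p^k} = F^k_* P` of a module: the group `P`, on which a ring `A`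
acting on `P` acts through `a ↦ a ^ (p ^ k)`. -/
def Frob (_p _k : ℕ) (P : Type*) : Type _ := P

/-- The identity map `P → F^k_* P`, `x ↦ x^{1/p^k}`. -/
def toFrob (p k : ℕ) {P : Type*} (x : P) : Frob p k P := x

/-- The identity map `F^k_* P → P`. -/
def ofFrob {p k : ℕ} {P : Type*} (x : Frob p k P) : P := x

/-- The ring `A^{1/p^k} = F^k_* A`: the ring `A`, regarded as an `A`-algebra through
`a ↦ a ^ (p ^ k)`. -/
def Root (_p _k : ℕ) (A : Type*) : Type _ := A

/-- The identity map `A → A^{1/p^k}`, `a ↦ a^{1/p^k}`. -/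
def toRoot (p k : ℕ) {A : Type*} (a : A) : Root p k A := a

/-- The identity map `A^{1/p^k} → A`. -/
def ofRoot {p k : ℕ} {A : Type*} (a : Root p k A) : A := a

section FrobInstances

variable (p k : ℕ)

instance (P : Type*) [AddCommGroup P] : AddCommGroup (Frob p k P) := inferInstanceAs (AddCommGroup P)

instance (B : Type*) [CommRing B] : CommRing (Root p k B) := inferInstanceAs (CommRing B)

/-- `P^{1/p^k}` is a module over the ring `B^{1/p^k}` when `P` is a `B`-module. -/
instance (B P : Type*) [CommRing B] [AddCommGroup P] [Module B P] :
    Module (Root p k B) (Frob p k P) :=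
  inferInstanceAs (Module B P)

/-- A ring homomorphism `A → B` regarded as a homomorphism `A^{1/p^k} → B^{1/p^k}`. -/
def rootMap {A B : Type*} [CommRing A] [CommRing B] (g : A →+* B) : Root p k A →+* Root p k B := g

variable [Fact p.Prime]

instance (A P : Type*) [CommRing A] [InCharP p A] [AddCommGroup P] [Module A P] :
    Module A (Frob p k P) :=
  Module.compHom P (iterFrob p k A)

instance (A B : Type*) [CommRing A] [InCharP p A] [CommRing B] [Algebra A B] :
    Algebra A (Root p k B) :=
  RingHom.toAlgebra (S := Root p k B) ((algebraMap A B).comp (iterFrob p k A))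

instance (A P : Type*) [CommRing A] [InCharP p A] [AddCommGroup P] [Module A P] :
    IsScalarTower A (Root p k A) (Frob p k P) where
  smul_assoc a b x := mul_smul (α := A) (β := P) (a ^ p ^ k) b x

/-- `(A^{1/p^k})^{1/p^e} = A^{1/p^{k+e}}`. -/
def frobRoot (e : ℕ) (A : Type*) [CommRing A] [InCharP p A] :
    Frob p e (Root p k A) →ₗ[A] Root p (k + e) A where
  toFun x := toRoot p (k + e) (ofRoot (ofFrob x))
  map_add' _ _ := rfl
  map_smul' a x := by
    have h : ((a ^ p ^ e) ^ p ^ k : A) = a ^ p ^ (k + e) := by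
      rw [← pow_mul, ← pow_add, add_comm e k]
    exact congrArg (fun b : A => b * (ofRoot (ofFrob x))) h

end FrobInstances

/-! ### External tensor products -/

/-- For an `S`-module `P` and an `S'`-module `P'`, the group `P ⊗[A] P'` regarded as a module over
`S ⊗[A] S'`, by `(s ⊗ s') • (x ⊗ x') = (s • x) ⊗ (s' • x')`. -/
def ExtTensor (A S S' P P' : Type*) [CommRing A] [CommRing S] [CommRing S'] [AddCommGroup P]
    [AddCommGroup P'] [Algebra A S] [Algebra A S'] [Module A P] [Module A P']
    [Module S P] [Module S' P'] [IsScalarTower A S P] [IsScalarTower A S' P'] : Type _ :=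
  P ⊗[A] P'

section ExtTensor

variable (A S S' P P' : Type*) [CommRing A] [CommRing S] [CommRing S'] [AddCommGroup P]
    [AddCommGroup P'] [Algebra A S] [Algebra A S'] [Module A P] [Module A P']
    [Module S P] [Module S' P'] [IsScalarTower A S P] [IsScalarTower A S' P']

instance : AddCommGroup (ExtTensor A S S' P P') := inferInstanceAs (AddCommGroup (P ⊗[A] P'))

/-- The action of `S ⊗[A] S'` on `P ⊗[A] P'`. -/
def extAction : S ⊗[A] S' →ₐ[A] Module.End A (P ⊗[A] P') :=
  (Module.endTensorEndAlgHom (R := A) (S := A) (A := A) (M := P) (N := P')).comp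
    (Algebra.TensorProduct.map (Algebra.lsmul A A P) (Algebra.lsmul A A P'))

instance : Module (S ⊗[A] S') (ExtTensor A S S' P P') :=
  Module.compHom (P ⊗[A] P') (extAction A S S' P P').toRingHom

instance : Module S (ExtTensor A S S' P P') :=
  Module.compHom (ExtTensor A S S' P P') (algebraMap S (S ⊗[A] S'))

instance : IsScalarTower S (S ⊗[A] S') (ExtTensor A S S' P P') where
  smul_assoc s t x := by
    rw [Algebra.smul_def, mul_smul]
    rfl

variable {A S S' P P'}

/-- The pure tensor `x ⊗ x'`. -/
def extTmul (x : P) (x' : P') : ExtTensor A S S' P P' := x ⊗ₜ[A] x'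

theorem smul_extTmul (s : S) (s' : S') (x : P) (x' : P') :
    (s ⊗ₜ[A] s') • (extTmul x x' : ExtTensor A S S' P P') = extTmul (s • x) (s' • x') := rfl

theorem ext_induction {motive : ExtTensor A S S' P P' → Prop} (x : ExtTensor A S S' P P')
    (h0 : motive 0) (ht : ∀ y y', motive (extTmul y y'))
    (ha : ∀ y y', motive y → motive y' → motive (y + y')) : motive x :=
  TensorProduct.induction_on (motive := motive) x h0 ht ha

end ExtTensor

/-! ### `p^{-e}`-linear maps and their iterates -/

/-- An `S`-linear map `N^{1/p^e} = F^e_* N → S`, i.e. an additive map `N → S` with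
`ψ (s ^ (p ^ e) • x) = s * ψ x`. -/
structure CartierMap (p e : ℕ) (S N : Type*) [CommRing S] [AddCommGroup N] [Module S N]
    extends N →+ S where
  map_smul' : ∀ (s : S) (x : N), toFun (s ^ p ^ e • x) = s * toFun x

/-- The source of the `n`-th iterate, as an `R`-module: it is `R` for `n = 0`, and
`(L ⊗_R D_n)^{1/p^e}` for `n + 1`. For invertible `L` this is canonically
`(L^{(p^{ne} - 1)/(p^e - 1)})^{1/p^{ne}}`. -/
def iterSource (p e : ℕ) [Fact p.Prime] (R L : Type u) [CommRing R] [InCharP p R]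
    [AddCommGroup L] [Module R L] : ℕ → ModuleCat.{u} R
  | 0 => ModuleCat.of R R
  | n + 1 => ModuleCat.of R (Frob p e (L ⊗[R] iterSource p e R L n))

namespace CartierMap

variable {p e : ℕ} [Fact p.Prime] {S N : Type u} [CommRing S] [InCharP p S] [AddCommGroup N]
  [Module S N]

/-- The composition `(N ⊗_S D)^{1/p^e} → (N ⊗_S S)^{1/p^e} = N^{1/p^e} → S` of `(N ⊗ g)^{1/p^e}`
and `ψ`, for an `S`-linear map `g : D → S`. -/
def step (ψ : CartierMap p e S N) {D : Type u} [AddCommGroup D] [Module S D] (g : D →ₗ[S] S) :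
    Frob p e (N ⊗[S] D) →ₗ[S] S where
  toFun x := ψ.toAddMonoidHom (TensorProduct.rid S N (g.lTensor N (ofFrob x)))
  map_add' x y := by
    have h : ofFrob (x + y) = ofFrob x + ofFrob y := rfl
    simp only [h, map_add]
  map_smul' s x := by
    have h : ofFrob (s • x) = s ^ p ^ e • ofFrob x := rfl
    rw [h, map_smul, map_smul]
    exact ψ.map_smul' _ _

/-- The `n`-th iterate `ψ^n : (N^{(p^{ne} - 1)/(p^e - 1)})^{1/p^{ne}} → S`; `ψ^{n+1}` is the
composition of `(N ⊗ ψ^n)^{1/p^e}` and `ψ`. -/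
def iter (ψ : CartierMap p e S N) : (n : ℕ) → iterSource p e S N n →ₗ[S] S
  | 0 => (LinearMap.id : S →ₗ[S] S)
  | n + 1 => ψ.step (iter ψ n)

/-- The image of `ψ^n`, an ideal of `S`. -/
def image (ψ : CartierMap p e S N) (n : ℕ) : Ideal S := LinearMap.range (ψ.iter n)

/-- The absolute non-`F`-pure ideal `σ(S, ψ)`: the intersection of the descending chain of the
images of the iterates of `ψ`; it is the stable value of the chain when the chain stabilizes. -/
def sigma (ψ : CartierMap p e S N) : Ideal S := ⨅ n, ψ.image n

end CartierMap

/-! ### Relative `p^{-e}`-linear maps, on affine charts -/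

/-- For an `A`-algebra `R`, an `R ⊗_A A^{1/p^e}`-linear map `L^{1/p^e} → R ⊗_A A^{1/p^e}`; the
element `r ⊗ a^{1/p^e}` acts on `L^{1/p^e}` through the relative Frobenius, that is, as
multiplication by `r ^ (p ^ e) * a` on `L`. -/
structure RelCartierMap (p e : ℕ) [Fact p.Prime] (A R L : Type*) [CommRing A] [InCharP p A]
    [CommRing R] [Algebra A R] [AddCommGroup L] [Module A L] [Module R L]
    extends L →+ R ⊗[A] Root p e A where
  map_smul' : ∀ (r : R) (a : A) (l : L),
    toFun (r ^ p ^ e • a • l) = (r ⊗ₜ[A] toRoot p e a) * toFun l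

/-- For a commutative square of ring homomorphisms from `A → R` to `A' → R'`, the induced ring
homomorphism `R ⊗_A A^{1/p^k} → R' ⊗_{A'} A'^{1/p^k}`. -/
def relRingMap (p k : ℕ) [Fact p.Prime] {A R A' R' : Type*} [CommRing A] [InCharP p A]
    [CommRing R] [Algebra A R] [CommRing A'] [InCharP p A'] [CommRing R'] [Algebra A' R']
    (g : A →+* A') (h : R →+* R') (hgh : h.comp (algebraMap A R) = (algebraMap A' R').comp g) :
    R ⊗[A] Root p k A →+* R' ⊗[A'] Root p k A' :=
  Algebra.TensorProduct.mapRingHom g h (rootMap p k g) hgh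
    (RingHom.ext fun a => map_pow g a (p ^ k))

/-- For an `A`-algebra `B` and `R_B = B ⊗_A R`, the ring homomorphism
`R ⊗_A A^{1/p^k} → R ⊗_A B^{1/p^k} = R_B ⊗_B B^{1/p^k}`. -/
def baseRingMap (p k : ℕ) [Fact p.Prime] (A R B : Type*) [CommRing A] [InCharP p A]
    [CommRing R] [Algebra A R] [CommRing B] [InCharP p B] [Algebra A B] :
    R ⊗[A] Root p k A →+* (B ⊗[A] R) ⊗[B] Root p k B :=
  relRingMap p k (algebraMap A B) (Algebra.TensorProduct.includeRight : R →ₐ[A] B ⊗[A] R).toRingHom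
    (RingHom.ext fun a => by
      simp)

namespace RelCartierMap

variable {p e : ℕ} [Fact p.Prime] {A R L : Type u} [CommRing A] [InCharP p A]
    [CommRing R] [InCharP p R] [Algebra A R] [AddCommGroup L] [Module A L] [Module R L]
    [IsScalarTower A R L]

/-- For `x ∈ P`, the map `R ⊗_A A^{1/p^e} → R ⊗_A P^{1/p^e}` given by
`r ⊗ a^{1/p^e} ↦ r ⊗ (a x)^{1/p^e}`. -/
def actOn (p e : ℕ) [Fact p.Prime] (A R : Type*) [CommRing A] [InCharP p A] [CommRing R]
    [Algebra A R] {P : Type*} [AddCommGroup P] [Module A P] (x : P) :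
    R ⊗[A] Root p e A →ₗ[R] R ⊗[A] Frob p e P :=
  LinearMap.baseChange R
    (((LinearMap.toSpanSingleton (Root p e A) (Frob p e P) (toFrob p e x)).restrictScalars A))

@[simp]
theorem actOn_tmul {P : Type*} [AddCommGroup P] [Module A P] (x : P) (r : R) (a : A) :
    actOn p e A R x (r ⊗ₜ toRoot p e a) = r ⊗ₜ toFrob p e (a • x) := rfl

theorem actOn_add {P : Type*} [AddCommGroup P] [Module A P] (x y : P)
    (t : R ⊗[A] Root p e A) : actOn p e A R (x + y) t = actOn p e A R x t + actOn p e A R y t := by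
  induction t with
  | zero => simp
  | add t t' h h' => rw [map_add, map_add, map_add, h, h']; abel
  | tmul r a =>
    change actOn p e A R (x + y) (r ⊗ₜ toRoot p e (ofRoot a)) =
      actOn p e A R x (r ⊗ₜ toRoot p e (ofRoot a)) + actOn p e A R y (r ⊗ₜ toRoot p e (ofRoot a))
    rw [actOn_tmul, actOn_tmul, actOn_tmul, smul_add, ← TensorProduct.tmul_add]
    rfl

theorem actOn_one_tmul_mul {P : Type*} [AddCommGroup P] [Module A P] (a : A) (x : P)
    (t : R ⊗[A] Root p e A) :
    actOn p e A R x (((1 : R) ⊗ₜ toRoot p e a) * t) = actOn p e A R (a • x) t := by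
  induction t with
  | zero => simp
  | add t t' h h' => rw [mul_add, map_add, map_add, h, h']
  | tmul r b =>
    rw [Algebra.TensorProduct.tmul_mul_tmul, one_mul]
    change actOn p e A R x (r ⊗ₜ toRoot p e (a * ofRoot b)) =
      actOn p e A R (a • x) (r ⊗ₜ toRoot p e (ofRoot b))
    rw [actOn_tmul, actOn_tmul, mul_comm, mul_smul]

/-- `actOn` as a biadditive map. -/
def actHom (p e : ℕ) [Fact p.Prime] (A R P : Type u) [CommRing A] [InCharP p A] [CommRing R]
    [InCharP p R] [Algebra A R] [AddCommGroup P] [Module A P] :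
    P →+ R ⊗[A] Root p e A →+ R ⊗[A] Frob p e P :=
  AddMonoidHom.mk' (fun x => (actOn p e A R x).toAddMonoidHom)
    (fun x y => AddMonoidHom.ext fun t => actOn_add x y t)

/-- The map `φ ⊗_{A^{1/p^e}} P^{1/p^e}`, from
`(L ⊗_A P)^{1/p^e} = L^{1/p^e} ⊗_{A^{1/p^e}} P^{1/p^e}` to
`(R ⊗_A A^{1/p^e}) ⊗_{A^{1/p^e}} P^{1/p^e} = R ⊗_A P^{1/p^e}`, for an `A`-module `P`: it sends
`l ⊗ x` to `φ(l) · x`. -/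
def twist (φ : RelCartierMap p e A R L) (P : Type u) [AddCommGroup P] [Module A P] :
    L ⊗[A] P →+ R ⊗[A] Frob p e P :=
  TensorProduct.liftAddHom ((actHom p e A R P).flip.comp φ.toAddMonoidHom) (fun a l x => by
    have h := φ.map_smul' 1 a l
    rw [one_pow, one_smul] at h
    change actOn p e A R x (φ.toFun (a • l)) = actOn p e A R (a • x) (φ.toFun l)
    rw [h]
    exact actOn_one_tmul_mul a x _)

@[simp]
theorem twist_tmul (φ : RelCartierMap p e A R L) {P : Type u} [AddCommGroup P] [Module A P]
    (l : L) (x : P) : φ.twist P (l ⊗ₜ x) = actOn p e A R x (φ.toAddMonoidHom l) := rfl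

theorem twist_pow_smul (φ : RelCartierMap p e A R L) {P : Type u} [AddCommGroup P] [Module A P]
    (r : R) (t : L ⊗[A] P) : φ.twist P (r ^ p ^ e • t) = r • φ.twist P t := by
  induction t with
  | zero => simp
  | add x y hx hy => rw [smul_add, map_add, hx, hy, map_add, smul_add]
  | tmul l x =>
    have h := φ.map_smul' r 1 l
    rw [one_smul] at h
    rw [TensorProduct.smul_tmul', twist_tmul, twist_tmul]
    change actOn p e A R x (φ.toFun _) = _
    rw [h, ← map_smul, Algebra.smul_def]
    rfl

/-- The composition
`(L ⊗_R D)^{1/p^e} → (L ⊗_R (R ⊗_A A^{1/p^k}))^{1/p^e} = L^{1/p^e} ⊗_{A^{1/p^e}} A^{1/p^{k+e}}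
→ R ⊗_A A^{1/p^{k+e}}` of `(L ⊗ g)^{1/p^e}` and `φ ⊗_{A^{1/p^e}} A^{1/p^{k+e}}`, for an `R`-linear
map `g : D → R ⊗_A A^{1/p^k}`. -/
def step (φ : RelCartierMap p e A R L) (k : ℕ) {D : Type u} [AddCommGroup D] [Module R D]
    (g : D →ₗ[R] R ⊗[A] Root p k A) :
    Frob p e (L ⊗[R] D) →ₗ[R] R ⊗[A] Root p (k + e) A where
  toFun x := LinearMap.baseChange R (frobRoot p k e A) (φ.twist (Root p k A)
    (TensorProduct.AlgebraTensorModule.cancelBaseChange A R R L (Root p k A)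
      (g.lTensor L (ofFrob x))))
  map_add' x y := by
    have h : ofFrob (x + y) = ofFrob x + ofFrob y := rfl
    simp only [h, map_add]
  map_smul' r x := by
    have h : ofFrob (r • x) = r ^ p ^ e • ofFrob x := rfl
    rw [h, map_smul, map_smul, twist_pow_smul, map_smul]
    rfl

/-- The `n`-th iterate
`φ^n : (L^{(p^{ne} - 1)/(p^e - 1)})^{1/p^{ne}} → R ⊗_A A^{1/p^{ne}}`; `φ^{n+1}` is the composition
of `(L ⊗ φ^n)^{1/p^e}` and `φ ⊗_{A^{1/p^e}} A^{1/p^{(n+1)e}}`. -/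
def iter (φ : RelCartierMap p e A R L) :
    (n : ℕ) → iterSource p e R L n →ₗ[R] R ⊗[A] Root p (e * n) A
  | 0 => (Algebra.linearMap R (R ⊗[A] Root p (e * 0) A) : R →ₗ[R] _)
  | n + 1 => φ.step (e * n) (iter φ n)

/-- The `n`-th relative non-`F`-pure ideal `σ_n` of `R ⊗_A A^{1/p^{ne}}`: the image of `φ^n`
(which is already closed under multiplication by `A^{1/p^{ne}}`). -/
def image (φ : RelCartierMap p e A R L) (n : ℕ) : Ideal (R ⊗[A] Root p (e * n) A) :=
  Ideal.span (Set.range (φ.iter n))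

/-! #### The induced absolute map `γ` -/

/-- For `Ψ : M^{1/p^e} → A`, the map `Ψ^{1/p^k} : M^{1/p^{k+e}} → A^{1/p^k}`. -/
def rootOf {M : Type u} [AddCommGroup M] [Module A M] (Ψ : CartierMap p e A M) (k : ℕ) :
    Frob p e (Frob p k M) →ₗ[A] Root p k A where
  toFun x := toRoot p k (Ψ.toAddMonoidHom (ofFrob (ofFrob x)))
  map_add' x y := Ψ.toAddMonoidHom.map_add (ofFrob (ofFrob x)) (ofFrob (ofFrob y))
  map_smul' a x := by
    have h := Ψ.map_smul' (a ^ p ^ k) (ofFrob (ofFrob x))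
    have h2 : ((a ^ p ^ k) ^ p ^ e : A) = (a ^ p ^ e) ^ p ^ k := by
      rw [← pow_mul, ← pow_mul, mul_comm]
    rw [h2] at h
    exact h

/-- The line bundle `N = L ⊗_A M^{1/p^{ne}}` over `R ⊗_A A^{1/p^{ne}}`. -/
abbrev GammaSource (p e : ℕ) [Fact p.Prime] (A R L M : Type u) [CommRing A] [InCharP p A]
    [CommRing R] [Algebra A R] [AddCommGroup L] [Module A L] [Module R L]
    [IsScalarTower A R L] [AddCommGroup M] [Module A M] (n : ℕ) : Type u :=
  ExtTensor A R (Root p (e * n) A) L (Frob p (e * n) M)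

/-- The additive map underlying `γ`. -/
def gammaAux {M : Type u} [AddCommGroup M] [Module A M] (φ : RelCartierMap p e A R L)
    (Ψ : CartierMap p e A M) (n : ℕ) :
    GammaSource p e A R L M n →+ R ⊗[A] Root p (e * n) A :=
  (LinearMap.baseChange R (rootOf Ψ (e * n))).toAddMonoidHom.comp (φ.twist (Frob p (e * n) M))

theorem baseChange_rootOf_actOn {M : Type u} [AddCommGroup M] [Module A M]
    (Ψ : CartierMap p e A M) (k : ℕ) (b : Root p k A) (m : Frob p k M)
    (t : R ⊗[A] Root p e A) :
    LinearMap.baseChange R (rootOf Ψ k) (actOn p e A R (b ^ p ^ e • m) t) =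
      ((1 : R) ⊗ₜ b) * LinearMap.baseChange R (rootOf Ψ k) (actOn p e A R m t) := by
  induction t with
  | zero => simp
  | add t t' h h' => rw [map_add, map_add, h, h', map_add, map_add, mul_add]
  | tmul r a =>
    change r ⊗ₜ rootOf Ψ k (toFrob p e (ofRoot a • (b ^ p ^ e • m))) =
      ((1 : R) ⊗ₜ b) * (r ⊗ₜ rootOf Ψ k (toFrob p e (ofRoot a • m)))
    rw [Algebra.TensorProduct.tmul_mul_tmul, one_mul]
    congr 1
    have h := Ψ.map_smul' (ofRoot b) ((ofRoot a ^ p ^ k : A) • (ofFrob m : M))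
    rw [smul_comm] at h
    exact h

theorem gammaAux_smul {M : Type u} [AddCommGroup M] [Module A M] (φ : RelCartierMap p e A R L)
    (Ψ : CartierMap p e A M) (n : ℕ) (s : R ⊗[A] Root p (e * n) A)
    (x : GammaSource p e A R L M n) :
    gammaAux φ Ψ n (s ^ p ^ e • x) = s * gammaAux φ Ψ n x := by
  induction x using ext_induction with
  | h0 => rw [smul_zero, map_zero, mul_zero]
  | ha x y hx hy => rw [smul_add, map_add, hx, hy, map_add, mul_add]
  | ht l m =>
    induction s with
    | zero =>
      rw [zero_pow (pow_ne_zero _ (Fact.out : p.Prime).ne_zero), zero_smul, map_zero, zero_mul]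
    | add s t hs ht => rw [add_pow_prime_pow, add_smul, map_add, hs, ht, add_mul]
    | tmul r b =>
      rw [Algebra.TensorProduct.tmul_pow, smul_extTmul]
      have h := φ.map_smul' r 1 l
      rw [one_smul] at h
      change LinearMap.baseChange R (rootOf Ψ (e * n)) (actOn p e A R (b ^ p ^ e • m)
        (φ.toFun (r ^ p ^ e • l))) = (r ⊗ₜ b) *
          LinearMap.baseChange R (rootOf Ψ (e * n)) (actOn p e A R m (φ.toFun l))
      rw [h, baseChange_rootOf_actOn]
      have h2 : (r ⊗ₜ[A] toRoot p e (1 : A)) * φ.toFun l = r • φ.toFun l := by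
        rw [Algebra.smul_def]; rfl
      have h3 : (r ⊗ₜ[A] b) = ((1 : R) ⊗ₜ[A] b) * algebraMap R (R ⊗[A] Root p (e * n) A) r := by
        rw [Algebra.TensorProduct.algebraMap_apply, Algebra.TensorProduct.tmul_mul_tmul]
        simp
      rw [h2, map_smul, map_smul, h3, mul_assoc, ← Algebra.smul_def]

/-- The map `γ : N^{1/p^e} = L^{1/p^e} ⊗_{A^{1/p^e}} M^{1/p^{(n+1)e}} → R ⊗_A A^{1/p^{ne}}`, the
composition of `φ ⊗ M^{1/p^{(n+1)e}}` (with values in `R ⊗_A M^{1/p^{(n+1)e}}`) and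
`R ⊗_A Ψ^{1/p^{ne}}`. -/
def gamma {M : Type u} [AddCommGroup M] [Module A M] (φ : RelCartierMap p e A R L)
    (Ψ : CartierMap p e A M) (n : ℕ) :
    CartierMap p e (R ⊗[A] Root p (e * n) A) (GammaSource p e A R L M n) where
  toAddMonoidHom := gammaAux φ Ψ n
  map_smul' s x := gammaAux_smul φ Ψ n s x

/-! #### Base change and fibres -/

theorem one_tmul_mul_baseRingMap (B : Type u) [CommRing B] [InCharP p B] [Algebra A B] (a : A)
    (t : R ⊗[A] Root p e A) :
    baseRingMap p e A R B (((1 : R) ⊗ₜ toRoot p e a) * t) =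
      ((1 : B ⊗[A] R) ⊗ₜ[B] toRoot p e (algebraMap A B a)) * baseRingMap p e A R B t := by
  rw [map_mul]
  congr 1
  simp only [baseRingMap, relRingMap, Algebra.TensorProduct.mapRingHom_tmul, map_one]
  rfl

/-- The biadditive map `(b, l) ↦ b^{1/p^e} · φ(l)`. -/
def baseChangeAux (φ : RelCartierMap p e A R L) (B : Type u) [CommRing B] [InCharP p B]
    [Algebra A B] : B →+ L →+ (B ⊗[A] R) ⊗[B] Root p e B :=
  (AddMonoidHom.mul.comp (AddMonoidHom.mk' (fun b => (1 : B ⊗[A] R) ⊗ₜ[B] toRoot p e b)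
    (fun b b' => TensorProduct.tmul_add _ (toRoot p e b) (toRoot p e b')))).compl₂
    ((baseRingMap p e A R B).toAddMonoidHom.comp φ.toAddMonoidHom)

/-- The additive map underlying `φ_B`. -/
def baseChangeHom (φ : RelCartierMap p e A R L) (B : Type u) [CommRing B] [InCharP p B]
    [Algebra A B] : ExtTensor A B R B L →+ (B ⊗[A] R) ⊗[B] Root p e B :=
  TensorProduct.liftAddHom (R := A) (baseChangeAux φ B) (fun a b l => by
    have h := φ.map_smul' 1 a l
    rw [one_pow, one_smul] at h
    change ((1 : B ⊗[A] R) ⊗ₜ[B] toRoot p e (a • b)) * baseRingMap p e A R B (φ.toFun l) =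
      ((1 : B ⊗[A] R) ⊗ₜ[B] toRoot p e b) * baseRingMap p e A R B (φ.toFun (a • l))
    rw [h, one_tmul_mul_baseRingMap, ← mul_assoc, Algebra.TensorProduct.tmul_mul_tmul, one_mul]
    congr 2
    rw [Algebra.smul_def, mul_comm]
    rfl)

theorem baseChangeHom_extTmul (φ : RelCartierMap p e A R L) (B : Type u) [CommRing B]
    [InCharP p B] [Algebra A B] (b : B) (l : L) :
    baseChangeHom φ B (extTmul b l) =
      ((1 : B ⊗[A] R) ⊗ₜ[B] toRoot p e b) * baseRingMap p e A R B (φ.toFun l) := rfl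

theorem baseChangeHom_smul (φ : RelCartierMap p e A R L) (B : Type u) [CommRing B] [InCharP p B]
    [Algebra A B] (r : B ⊗[A] R) (b : B) (x : ExtTensor A B R B L) :
    baseChangeHom φ B (r ^ p ^ e • b • x) = (r ⊗ₜ[B] toRoot p e b) * baseChangeHom φ B x := by
  induction x using ext_induction with
  | h0 => rw [smul_zero, smul_zero, map_zero, mul_zero]
  | ha x y hx hy => rw [smul_add, smul_add, map_add, hx, hy, map_add, mul_add]
  | ht b' l =>
    induction r with
    | zero =>
      rw [zero_pow (pow_ne_zero _ (Fact.out : p.Prime).ne_zero), zero_smul, map_zero,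
        TensorProduct.zero_tmul, zero_mul]
    | add s t hs ht =>
      rw [add_pow_prime_pow, add_smul, map_add, hs, ht, TensorProduct.add_tmul, add_mul]
    | tmul c r =>
      have h1 : b • (extTmul b' l : ExtTensor A B R B L) = extTmul (b * b') l := by
        change (b ⊗ₜ[A] (1 : R)) • (extTmul b' l : ExtTensor A B R B L) = _
        rw [smul_extTmul, one_smul, smul_eq_mul]
      have h := φ.map_smul' r 1 l
      rw [one_smul] at h
      rw [h1, Algebra.TensorProduct.tmul_pow, smul_extTmul, baseChangeHom_extTmul,
        baseChangeHom_extTmul, h, map_mul, ← mul_assoc, ← mul_assoc]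
      congr 1
      have h3 : baseRingMap p e A R B (r ⊗ₜ toRoot p e (1 : A)) =
          ((1 : B) ⊗ₜ[A] r) ⊗ₜ[B] (1 : Root p e B) := by
        simp only [baseRingMap, relRingMap, Algebra.TensorProduct.mapRingHom_tmul]
        congr 1
        exact map_one (algebraMap A B)
      have h4 : (c ⊗ₜ[A] r) = c • ((1 : B) ⊗ₜ[A] r) := by
        rw [TensorProduct.smul_tmul', smul_eq_mul, mul_one]
      rw [h3, h4, Algebra.TensorProduct.tmul_mul_tmul, Algebra.TensorProduct.tmul_mul_tmul, one_mul,
        mul_one, mul_one, TensorProduct.smul_tmul]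
      rfl

/-- The base change `φ_B : L_B^{1/p^e} = L^{1/p^e} ⊗_{A^{1/p^e}} B^{1/p^e} → R_B ⊗_B B^{1/p^e}` of
`φ` along `A → B`, where `R_B = B ⊗_A R` and `L_B = B ⊗_A L`; it sends `b ⊗ l` to
`b^{1/p^e} · φ(l)`. -/
def baseChange (φ : RelCartierMap p e A R L) (B : Type u) [CommRing B] [InCharP p B]
    [Algebra A B] : RelCartierMap p e B (B ⊗[A] R) (ExtTensor A B R B L) where
  toAddMonoidHom := baseChangeHom φ B
  map_smul' r b x := baseChangeHom_smul φ B r b x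

/-- For a perfect field `K`, the isomorphism `K^{1/p^e} → K`, `x^{1/p^e} ↦ x^{1/p^e}`. -/
def perfectRoot (p e : ℕ) [Fact p.Prime] (K : Type u) [Field K] [CharP K p] [PerfectRing K p] :
    Root p e K →ₗ[K] K where
  toFun x := (iterateFrobeniusEquiv K p e).symm (ofRoot x)
  map_add' x y := map_add (iterateFrobeniusEquiv K p e).symm (ofRoot x) (ofRoot y)
  map_smul' a x := by
    change (iterateFrobeniusEquiv K p e).symm (a ^ p ^ e * ofRoot x) =
      a * (iterateFrobeniusEquiv K p e).symm (ofRoot x)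
    rw [map_mul]
    congr 1
    exact (iterateFrobeniusEquiv K p e).symm_apply_apply a

/-- Over a perfect field `K`, a relative map `φ : L^{1/p^e} → R ⊗_K K^{1/p^e} ≅ R` viewed as an
absolute `p^{-e}`-linear map `ψ : L^{1/p^e} → R`. -/
def toAbsolute {K R L : Type u} [Field K] [CharP K p] [PerfectRing K p] [CommRing R] [Algebra K R]
    [AddCommGroup L] [Module K L] [Module R L] [IsScalarTower K R L]
    (φ : RelCartierMap p e K R L) : CartierMap p e R L where
  toAddMonoidHom := ((TensorProduct.AlgebraTensorModule.rid K R R).toLinearMap ∘ₗ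
    LinearMap.baseChange R (perfectRoot p e K)).toAddMonoidHom.comp φ.toAddMonoidHom
  map_smul' s x := by
    have h := φ.map_smul' s 1 x
    rw [one_smul] at h
    have h2 : (s ⊗ₜ[K] toRoot p e (1 : K)) * φ.toFun x = s • φ.toFun x := by
      rw [Algebra.smul_def]; rfl
    rw [h2] at h
    change ((TensorProduct.AlgebraTensorModule.rid K R R).toLinearMap ∘ₗ
      LinearMap.baseChange R (perfectRoot p e K)) (φ.toFun (s ^ p ^ e • x)) = s • _
    rw [h, map_smul]
    rfl

/-- The map `ψ_u : L_K^{1/p^e} → R_K` on the fibre over a perfect field `K`: the base change `φ_K`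
viewed as an absolute `p^{-e}`-linear map. -/
def fiberMap (φ : RelCartierMap p e A R L) (K : Type u) [Field K] [CharP K p] [PerfectRing K p]
    [Algebra A K] : CartierMap p e (K ⊗[A] R) (ExtTensor A K R K L) :=
  (φ.baseChange K).toAbsolute

end RelCartierMap

/-! ### Schemes -/

/-- `V` is a scheme of characteristic `p`, i.e. `p = 0` in `𝒪_V`. -/
class SchemeCharP (p : ℕ) (V : Scheme.{u}) : Prop where
  cast_eq_zero : (p : Γ(V, ⊤)) = 0

instance (p : ℕ) (V : Scheme.{u}) [SchemeCharP p V] (W : V.Opens) : InCharP p Γ(V, W) where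
  cast_eq_zero := by
    have h := congrArg (V.presheaf.map (homOfLE le_top : W ⟶ ⊤).op).hom
      (SchemeCharP.cast_eq_zero (p := p) (V := V))
    simpa using h

/-- `V` is `F`-finite: the Frobenius endomorphism is a finite morphism. -/
def IsFFinite (p : ℕ) [Fact p.Prime] (V : Scheme.{u}) [SchemeCharP p V] : Prop :=
  ∀ W : V.affineOpens, (iterFrob p 1 Γ(V, W.1)).Finite

/-- `V` is `F`-pure: locally on `V` the Frobenius `𝒪_V → F_* 𝒪_V` splits. (For `F`-finite
Noetherian schemes this is equivalent to the purity of Frobenius at all local rings.) -/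
def IsFPure (p : ℕ) (V : Scheme.{u}) : Prop :=
  ∀ v : V, ∃ W : V.affineOpens, v ∈ W.1 ∧
    ∃ θ : CartierMap p 1 Γ(V, W.1) Γ(V, W.1), θ.toAddMonoidHom 1 = 1

/-- `L` is a line bundle: every point has an open neighbourhood `U` on which some section `s`
trivializes `L`. -/
def IsLineBundle {X : Scheme.{u}} (L : X.Modules) : Prop :=
  ∀ x : X, ∃ (U : X.Opens) (_ : x ∈ U) (s : Γ(L, U)), ∀ (U' : X.Opens) (h : U' ≤ U),
    Function.Bijective fun r : Γ(X, U') => r • L.presheaf.map (homOfLE h).op s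

/-- An `𝒪_V`-linear map `F^e_* M → 𝒪_V`, given on affine opens. -/
structure SheafCartierMap (p e : ℕ) (V : Scheme.{u}) (M : V.Modules) where
  app (W : V.affineOpens) : CartierMap p e Γ(V, W.1) Γ(M, W.1)
  app_res {W' W : V.affineOpens} (h : W'.1 ≤ W.1) (m : Γ(M, W.1)) :
    (app W').toAddMonoidHom (M.presheaf.map (homOfLE h).op m) =
      V.presheaf.map (homOfLE h).op ((app W).toAddMonoidHom m)

/-- `Ψ` generates `ℋom(F^e_* M, 𝒪_V)` as an `F^e_* 𝒪_V`-module. On a quasi-Gorenstein scheme this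
is the case for the standard map out of `M = ω_V^{1 - p^e} = 𝒪_V((1 - p^e) K_V)`. -/
def SheafCartierMap.Generates {p e : ℕ} {V : Scheme.{u}} {M : V.Modules}
    (Ψ : SheafCartierMap p e V M) : Prop :=
  ∀ (W : V.affineOpens) (θ : CartierMap p e Γ(V, W.1) Γ(M, W.1)),
    ∃ a : Γ(V, W.1), ∀ m, θ.toAddMonoidHom m = (Ψ.app W).toAddMonoidHom (a • m)

/-- An affine chart of `f : X ⟶ V`: affine opens `U ⊆ X` and `W ⊆ V` with `f(U) ⊆ W`. -/
structure Chart {X V : Scheme.{u}} (f : X ⟶ V) where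
  U : X.affineOpens
  W : V.affineOpens
  le : U.1 ≤ f ⁻¹ᵁ W.1

namespace Chart

variable {X V : Scheme.{u}} {f : X ⟶ V}

/-- The ring `A = 𝒪_V(W)`. -/
def A (c : Chart f) : Type u := Γ(V, c.W.1)

/-- The ring `R = 𝒪_X(U)`. -/
def R (c : Chart f) : Type u := Γ(X, c.U.1)

/-- The `R`-module `L(U)`. -/
def sec (c : Chart f) (L : X.Modules) : Type u := Γ(L, c.U.1)

/-- The `A`-module `M(W)`. -/
def baseSec (c : Chart f) (M : V.Modules) : Type u := Γ(M, c.W.1)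

instance (c : Chart f) : CommRing c.A := inferInstanceAs (CommRing Γ(V, c.W.1))

instance (c : Chart f) : CommRing c.R := inferInstanceAs (CommRing Γ(X, c.U.1))

instance (c : Chart f) : Algebra c.A c.R :=
  RingHom.toAlgebra (R := c.A) (S := c.R) (f.appLE c.W.1 c.U.1 c.le).hom

instance (c : Chart f) (L : X.Modules) : AddCommGroup (c.sec L) :=
  inferInstanceAs (AddCommGroup Γ(L, c.U.1))

instance (c : Chart f) (L : X.Modules) : Module c.R (c.sec L) :=
  inferInstanceAs (Module Γ(X, c.U.1) Γ(L, c.U.1))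

instance (c : Chart f) (L : X.Modules) : Module c.A (c.sec L) :=
  Module.compHom (c.sec L) (algebraMap c.A c.R)

instance (c : Chart f) (L : X.Modules) : IsScalarTower c.A c.R (c.sec L) where
  smul_assoc a r x := by
    rw [Algebra.smul_def, mul_smul]
    rfl

instance (c : Chart f) (M : V.Modules) : AddCommGroup (c.baseSec M) :=
  inferInstanceAs (AddCommGroup Γ(M, c.W.1))

instance (c : Chart f) (M : V.Modules) : Module c.A (c.baseSec M) :=
  inferInstanceAs (Module Γ(V, c.W.1) Γ(M, c.W.1))

instance (p : ℕ) [SchemeCharP p V] (c : Chart f) : InCharP p c.A :=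
  inferInstanceAs (InCharP p Γ(V, c.W.1))

instance (p : ℕ) [SchemeCharP p V] (c : Chart f) : InCharP p c.R where
  cast_eq_zero := by
    have h := congrArg (algebraMap c.A c.R) (InCharP.cast_eq_zero (p := p) (A := c.A))
    simpa using h

/-- Restriction of functions on the base to a smaller chart. -/
def resA {c' c : Chart f} (h : c'.W.1 ≤ c.W.1) : c.A →+* c'.A :=
  (V.presheaf.map (homOfLE h).op).hom

/-- Restriction of functions to a smaller chart. -/
def resR {c' c : Chart f} (h : c'.U.1 ≤ c.U.1) : c.R →+* c'.R :=
  (X.presheaf.map (homOfLE h).op).hom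

/-- Restriction of sections of `L` to a smaller chart. -/
def resSec {c' c : Chart f} (h : c'.U.1 ≤ c.U.1) (L : X.Modules) : c.sec L →+ c'.sec L :=
  (L.presheaf.map (homOfLE h).op).hom

theorem resR_comp {c' c : Chart f} (hU : c'.U.1 ≤ c.U.1) (hW : c'.W.1 ≤ c.W.1) :
    (resR hU).comp (algebraMap c.A c.R) = (algebraMap c'.A c'.R).comp (resA hW) := by
  have h1 : f.appLE c.W.1 c.U.1 c.le ≫ X.presheaf.map (homOfLE hU).op =
      f.appLE c.W.1 c'.U.1 (hU.trans c.le) := Scheme.Hom.appLE_map _ _ _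
  have h2 : V.presheaf.map (homOfLE hW).op ≫ f.appLE c'.W.1 c'.U.1 c'.le =
      f.appLE c.W.1 c'.U.1 (hU.trans c.le) := Scheme.Hom.map_appLE _ _ _
  exact congrArg CommRingCat.Hom.hom (h1.trans h2.symm)

/-- For a point `u : Spec K ⟶ V` with image in `W`, the ring homomorphism `𝒪_V(W) → K`. -/
def evalAt (c : Chart f) {K : Type u} [Field K] (u : Spec (.of K) ⟶ V)
    (h : ⊤ ≤ u ⁻¹ᵁ c.W.1) : c.A →+* K :=
  ((Scheme.ΓSpecIso (.of K)).hom.hom).comp (u.appLE c.W.1 ⊤ h).hom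

end Chart

/-- `Ψ` on the base of an affine chart. -/
def SheafCartierMap.onChart {p e : ℕ} {X V : Scheme.{u}} {f : X ⟶ V} {M : V.Modules}
    (Ψ : SheafCartierMap p e V M) (c : Chart f) : CartierMap p e c.A (c.baseSec M) :=
  Ψ.app c.W

/-- An `𝒪_{X_{V^e}}`-linear map `φ : L^{1/p^e} → R_{A^{1/p^e}}`, that is,
`(F^e_{X^e/V^e})_* L → 𝒪_{X_{V^e}}` where `X_{V^e}` is the base change of `f : X ⟶ V` by the `e`-th
iterate of the Frobenius of `V` and `F^e_{X^e/V^e}` is the relative Frobenius. It is given on the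
affine charts `Spec (R ⊗_A A^{1/p^e})` of `X_{V^e}`, compatibly with restriction. -/
structure RelSheafCartierMap (p e : ℕ) [Fact p.Prime] {X V : Scheme.{u}} [SchemeCharP p V]
    (f : X ⟶ V) (L : X.Modules) where
  app (c : Chart f) : RelCartierMap p e c.A c.R (c.sec L)
  app_res {c' c : Chart f} (hU : c'.U.1 ≤ c.U.1) (hW : c'.W.1 ≤ c.W.1) (l : c.sec L) :
    (app c').toAddMonoidHom (Chart.resSec hU L l) =
      relRingMap p e (Chart.resA hW) (Chart.resR hU) (Chart.resR_comp hU hW)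
        ((app c).toAddMonoidHom l)

section GenericPoint

variable (p : ℕ) [Fact p.Prime] (V : Scheme.{u}) [IsIntegral V] [SchemeCharP p V]

theorem charP_functionField : CharP V.functionField p := by
  have h := congrArg (V.presheaf.germ ⊤ (genericPoint V) trivial).hom
    (SchemeCharP.cast_eq_zero (p := p) (V := V))
  have h0 : (p : V.functionField) = 0 := by
    simpa using h
  exact (CharP.charP_iff_prime_eq_zero Fact.out).2 h0

/-- The perfection `k(V^∞) = k(V)^{1/p^∞}` of the function field of `V`. -/
def perfectFunctionField : Type u :=
  haveI := charP_functionField p V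
  PerfectClosure V.functionField p

instance : Field (perfectFunctionField p V) :=
  haveI := charP_functionField p V
  inferInstanceAs (Field (PerfectClosure V.functionField p))

instance : CharP (perfectFunctionField p V) p :=
  haveI := charP_functionField p V
  inferInstanceAs (CharP (PerfectClosure V.functionField p) p)

instance : PerfectRing (perfectFunctionField p V) p :=
  haveI := charP_functionField p V
  inferInstanceAs (PerfectRing (PerfectClosure V.functionField p) p)

/-- The inclusion `k(V) → k(V^∞)`. -/
def toPerfectFunctionField : V.functionField →+* perfectFunctionField p V :=
  haveI := charP_functionField p V
  PerfectClosure.of V.functionField p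

/-- The perfect generic point `Spec k(V^∞) ⟶ V`. -/
def perfectGenericPoint : Spec (.of (perfectFunctionField p V)) ⟶ V :=
  Spec.map (CommRingCat.ofHom (toPerfectFunctionField p V)) ≫
    V.fromSpecStalk (genericPoint V)

end GenericPoint

namespace RelSheafCartierMap

variable {p e : ℕ} [Fact p.Prime] {X V : Scheme.{u}} [SchemeCharP p V] {f : X ⟶ V} {L : X.Modules}

/-- The relative non-`F`-pure ideal `σ_n(X/V, φ) ⊆ 𝒪_{X_{V^{ne}}}` on the chart
`Spec (R ⊗_A A^{1/p^{ne}})`. -/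
def sigmaN (φ : RelSheafCartierMap p e f L) (n : ℕ) (c : Chart f) :
    Ideal (c.R ⊗[c.A] Root p (e * n) c.A) :=
  (φ.app c).image n

/-- The absolute non-`F`-pure ideal `σ(X_{V^{ne}}, γ) ⊆ 𝒪_{X_{V^{ne}}}` on the chart
`Spec (R ⊗_A A^{1/p^{ne}})`, where `γ` is the map induced by `φ` and `Ψ`. -/
def sigmaGamma (φ : RelSheafCartierMap p e f L) {M : V.Modules} (Ψ : SheafCartierMap p e V M)
    (n : ℕ) (c : Chart f) : Ideal (c.R ⊗[c.A] Root p (e * n) c.A) :=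
  ((φ.app c).gamma (Ψ.onChart c) n).sigma

/-- `n₀` is a uniform integer for `σ` over the generic point of `V`: the descending chain of the
images of the iterates of `ψ_∞` on `X_{k(V^∞)}` is constant from `n₀` on. -/
def IsUniformInteger [IsIntegral V] (φ : RelSheafCartierMap p e f L) (n₀ : ℕ) : Prop :=
  ∀ (c : Chart f) (h : ⊤ ≤ perfectGenericPoint p V ⁻¹ᵁ c.W.1),
    letI : Algebra c.A (perfectFunctionField p V) :=
      (c.evalAt (perfectGenericPoint p V) h).toAlgebra
    ∀ n, n₀ ≤ n → ((φ.app c).fiberMap (perfectFunctionField p V)).image n =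
      ((φ.app c).fiberMap (perfectFunctionField p V)).image n₀

end RelSheafCartierMap

end RelFrob

end

/-!
Extended to the next level, the images of the iterates `φⁿ` form a descending chain, and the
`(n + 1)`-st image is obtained from the `n`-th one by a push-forward compatible with base change
and with change of level. Hence one equality in the chain forces it to be stable from there on.
Stability at `n₀` on the perfect generic fibre descends, by faithful flatness and Noetherianity,
to a dense open subset of `V`. `F`-purity and the assumption that `Ψ` generates give, near the
generic point, a section `m` with `Ψ m = 1`, so that `Ψ (· m)` retracts the inclusion of a level
into the next. Where the chain is stable, the push-forward of `σₙ` under `γ` is therefore `σₙ`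
itself, whence `σ(γ) = σₙ`. On a perfect fibre, `K^{1/p^k} ≅ K` turns relative images into absolute
ones.
-/

noncomputable section

namespace RelFrob

/-! ### Change of level -/

section Level

variable {p : ℕ} [Fact p.Prime] {A R : Type*} [CommRing A] [InCharP p A] [CommRing R]
  [Algebra A R] {i j k : ℕ}

/-- The inclusion `A^{1/p^j} → A^{1/p^k}` for `j ≤ k`. -/
def rootUp (p : ℕ) [Fact p.Prime] (A : Type*) [CommRing A] [InCharP p A] {j k : ℕ} (h : j ≤ k) :
    Root p j A →ₐ[A] Root p k A where
  toRingHom := (iterFrob p (k - j) A : A →+* A)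
  commutes' a := by
    change (a ^ p ^ j) ^ p ^ (k - j) = a ^ p ^ k
    rw [← pow_mul, ← pow_add, Nat.add_sub_cancel' h]

/-- The inclusion of levels `R ⊗_A A^{1/p^j} → R ⊗_A A^{1/p^k}` for `j ≤ k`, along which ideals of
different levels are compared. -/
def levelUp (p : ℕ) [Fact p.Prime] (A R : Type*) [CommRing A] [InCharP p A] [CommRing R]
    [Algebra A R] {j k : ℕ} (h : j ≤ k) : R ⊗[A] Root p j A →ₐ[R] R ⊗[A] Root p k A :=
  Algebra.TensorProduct.map (AlgHom.id R R) (rootUp p A h)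

theorem levelUp_tmul (h : j ≤ k) (r : R) (a : Root p j A) :
    levelUp p A R h (r ⊗ₜ a) = r ⊗ₜ toRoot p k (ofRoot a ^ p ^ (k - j)) := rfl

theorem levelUp_comp_levelUp (h : i ≤ j) (h' : j ≤ k) :
    (levelUp p A R h').comp (levelUp p A R h) = levelUp p A R (h.trans h') := by
  refine Algebra.TensorProduct.ext (AlgHom.ext fun r => by simp [levelUp]) (AlgHom.ext fun a => ?_)
  change (1 : R) ⊗ₜ[A] toRoot p k ((ofRoot a ^ p ^ (j - i)) ^ p ^ (k - j)) =
    1 ⊗ₜ toRoot p k (ofRoot a ^ p ^ (k - i))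
  rw [← pow_mul, ← pow_add, add_comm, Nat.sub_add_sub_cancel h' h]

theorem levelUp_levelUp (h : i ≤ j) (h' : j ≤ k) (t : R ⊗[A] Root p i A) :
    levelUp p A R h' (levelUp p A R h t) = levelUp p A R (h.trans h') t :=
  DFunLike.congr_fun (levelUp_comp_levelUp h h') t

theorem levelUp_refl : levelUp p A R (le_refl k) = AlgHom.id R _ := by
  refine Algebra.TensorProduct.ext (AlgHom.ext fun r => by simp [levelUp]) (AlgHom.ext fun a => ?_)
  change (1 : R) ⊗ₜ[A] toRoot p k (ofRoot a ^ p ^ (k - k)) = 1 ⊗ₜ a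
  rw [Nat.sub_self, pow_zero, pow_one]
  rfl

theorem map_levelUp_map_levelUp (h : i ≤ j) (h' : j ≤ k) (J : Ideal (R ⊗[A] Root p i A)) :
    (J.map (levelUp p A R h)).map (levelUp p A R h') = J.map (levelUp p A R (h.trans h')) := by
  rw [Ideal.map_mapₐ, levelUp_comp_levelUp]

theorem map_levelUp_refl (J : Ideal (R ⊗[A] Root p k A)) :
    J.map (levelUp p A R (le_refl k)) = J := by
  rw [levelUp_refl]
  exact Ideal.map_id J

section Square

variable {A' R' : Type*} [CommRing A'] [InCharP p A'] [CommRing R'] [Algebra A' R']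
  (g : A →+* A') (h : R →+* R') (hgh : h.comp (algebraMap A R) = (algebraMap A' R').comp g)

theorem relRingMap_tmul (r : R) (a : Root p k A) :
    relRingMap p k g h hgh (r ⊗ₜ a) = h r ⊗ₜ toRoot p k (g (ofRoot a)) := by
  rw [relRingMap, Algebra.TensorProduct.mapRingHom_tmul]
  rfl

theorem relRingMap_levelUp (hjk : j ≤ k) (t : R ⊗[A] Root p j A) :
    relRingMap p k g h hgh (levelUp p A R hjk t) =
      levelUp p A' R' hjk (relRingMap p j g h hgh t) := by
  induction t with
  | zero => simp only [map_zero]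
  | add t t' ht ht' => simp only [map_add, ht, ht']
  | tmul r a =>
    rw [levelUp_tmul, relRingMap_tmul, relRingMap_tmul, levelUp_tmul]
    exact congrArg _ (map_pow g _ _)

theorem map_relRingMap_map_levelUp (hjk : j ≤ k) (J : Ideal (R ⊗[A] Root p j A)) :
    (J.map (levelUp p A R hjk)).map (relRingMap p k g h hgh) =
      (J.map (relRingMap p j g h hgh)).map (levelUp p A' R' hjk) := by
  change (J.map (levelUp p A R hjk).toRingHom).map _ = Ideal.map (levelUp p A' R' hjk).toRingHom _
  rw [Ideal.map_map, Ideal.map_map]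
  exact congrArg (J.map ·) (RingHom.ext fun t => relRingMap_levelUp g h hgh hjk t)

end Square

end Level

/-! ### Ideals generated by the values of a map out of a tensor product -/

section PushIdeal

variable {R L S T : Type*} [CommRing R] [AddCommGroup L] [Module R L] [CommRing S] [Algebra R S]
  [CommRing T]

/-- The ideal of `T` generated by the image of `L ⊗_R J` under an additive map `G : L ⊗_R S → T`,
for an ideal `J` of `S`. The images of the iterates of a `p^{-e}`-linear map arise from the unit
ideal by repeating this operation. -/
def pushIdeal (G : L ⊗[R] S →+ T) (J : Ideal S) : Ideal T :=
  Ideal.span {y | ∃ l : L, ∃ t ∈ J, G (l ⊗ₜ t) = y}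

/-- `S` acts on the values of `G : L ⊗_R S → T` through `T` and `L`, as is the case for maps that
are semilinear in `L`. -/
def IsBalanced (G : L ⊗[R] S →+ T) : Prop :=
  ∀ (l : L) (s t : S), G (l ⊗ₜ (s * t)) ∈ Ideal.span (Set.range fun l' : L => G (l' ⊗ₜ t))

theorem mem_pushIdeal (G : L ⊗[R] S →+ T) {J : Ideal S} (l : L) {t : S} (ht : t ∈ J) :
    G (l ⊗ₜ t) ∈ pushIdeal G J :=
  Ideal.subset_span ⟨l, t, ht, rfl⟩

theorem pushIdeal_le {G : L ⊗[R] S →+ T} {J : Ideal S} {I : Ideal T} :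
    pushIdeal G J ≤ I ↔ ∀ l, ∀ t ∈ J, G (l ⊗ₜ t) ∈ I := by
  rw [pushIdeal, Ideal.span_le]
  exact ⟨fun h l t ht => h ⟨l, t, ht, rfl⟩, fun h _ ⟨l, t, ht, hy⟩ => hy ▸ h l t ht⟩

theorem pushIdeal_mono (G : L ⊗[R] S →+ T) : Monotone (pushIdeal G) := fun _ _ h =>
  pushIdeal_le.2 fun l _ ht => mem_pushIdeal G l (h ht)

theorem IsBalanced.pushIdeal_span_le {G : L ⊗[R] S →+ T} (hG : IsBalanced G) {Z : Set S}
    {I : Ideal T} (h : ∀ l, ∀ t ∈ Z, G (l ⊗ₜ t) ∈ I) : pushIdeal G (Ideal.span Z) ≤ I := by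
  refine pushIdeal_le.2 fun l t ht => ?_
  induction ht using Submodule.closure_induction with
  | zero => rw [TensorProduct.tmul_zero, map_zero]; exact I.zero_mem
  | add t t' _ _ ht ht' => rw [TensorProduct.tmul_add, map_add]; exact I.add_mem ht ht'
  | smul_mem s t ht =>
    exact Ideal.span_le.2 (Set.range_subset_iff.2 fun l' => h l' t ht) (hG l s t)

theorem span_range_comp_lTensor {G : L ⊗[R] S →+ T} (hG : IsBalanced G) {D : Type*}
    [AddCommGroup D] [Module R D] (g : D →ₗ[R] S) :
    Ideal.span (Set.range fun x => G (g.lTensor L x)) =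
      pushIdeal G (Ideal.span (Set.range g)) := by
  apply le_antisymm
  · rw [Ideal.span_le, Set.range_subset_iff]
    intro x
    induction x with
    | zero => rw [map_zero, map_zero]; exact Ideal.zero_mem _
    | add x y hx hy => rw [map_add, map_add]; exact Ideal.add_mem _ hx hy
    | tmul l d => exact mem_pushIdeal G l (Ideal.subset_span ⟨d, rfl⟩)
  · refine hG.pushIdeal_span_le ?_
    rintro l _ ⟨d, rfl⟩
    exact Ideal.subset_span ⟨l ⊗ₜ d, rfl⟩

theorem IsBalanced.pushIdeal_map {R' L' S' T' : Type*} [CommRing R'] [AddCommGroup L']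
    [Module R' L'] [CommRing S'] [Algebra R' S'] [CommRing T'] {G : L ⊗[R] S →+ T}
    {G' : L' ⊗[R'] S' →+ T'} (hG' : IsBalanced G') (q : L → L') (α : S →+* S') (β : T →+* T')
    (hβ : ∀ l t, β (G (l ⊗ₜ t)) = G' (q l ⊗ₜ α t))
    (hq : ∀ l' t', G' (l' ⊗ₜ t') ∈ Ideal.span (Set.range fun l => G' (q l ⊗ₜ t')))
    (J : Ideal S) : pushIdeal G' (J.map α) = (pushIdeal G J).map β := by
  have mem_map (l : L) {t : S} (ht : t ∈ J) : G' (q l ⊗ₜ α t) ∈ (pushIdeal G J).map β :=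
    hβ l t ▸ Ideal.mem_map_of_mem β (mem_pushIdeal G l ht)
  apply le_antisymm
  · refine hG'.pushIdeal_span_le ?_
    rintro l' _ ⟨t, ht, rfl⟩
    exact Ideal.span_le.2 (Set.range_subset_iff.2 fun l => mem_map l ht) (hq l' (α t))
  · refine Ideal.map_le_iff_le_comap.2 (pushIdeal_le.2 fun l t ht => ?_)
    rw [Ideal.mem_comap, hβ]
    exact mem_pushIdeal G' _ (Ideal.mem_map_of_mem α ht)

end PushIdeal

/-! ### Images of the iterates -/

namespace CartierMap

variable {p e : ℕ} [Fact p.Prime] {S N : Type u} [CommRing S] [InCharP p S] [AddCommGroup N]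
  [Module S N] (ψ : CartierMap p e S N)

/-- The map `(N ⊗_S S)^{1/p^e} = N^{1/p^e} → S` through which the iterates of `ψ` are formed. -/
def onTensor : N ⊗[S] S →+ S :=
  ψ.toAddMonoidHom.comp (TensorProduct.rid S N).toAddEquiv.toAddMonoidHom

omit [Fact p.Prime] [InCharP p S] in
theorem onTensor_tmul (x : N) (t : S) :
    ψ.onTensor (x ⊗ₜ t) = ψ.toAddMonoidHom (t • x) := rfl

omit [Fact p.Prime] [InCharP p S] in
theorem isBalanced_onTensor : IsBalanced ψ.onTensor := fun x s t => by
  refine Ideal.subset_span ⟨s • x, ?_⟩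
  change ψ.onTensor ((s • x) ⊗ₜ t) = _
  rw [onTensor_tmul, onTensor_tmul, smul_comm, mul_smul]

theorem image_zero : ψ.image 0 = ⊤ := LinearMap.range_id

theorem image_succ (n : ℕ) : ψ.image (n + 1) = pushIdeal ψ.onTensor (ψ.image n) := by
  have h : Ideal.span (Set.range (ψ.iter (n + 1))) =
      pushIdeal ψ.onTensor (Ideal.span (Set.range (ψ.iter n))) :=
    span_range_comp_lTensor ψ.isBalanced_onTensor (ψ.iter n)
  rwa [← LinearMap.coe_range, ← LinearMap.coe_range, Ideal.span_eq, Ideal.span_eq] at h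

theorem image_antitone : Antitone ψ.image := by
  refine antitone_nat_of_succ_le fun n => ?_
  induction n with
  | zero => exact ψ.image_zero ▸ le_top
  | succ n ih =>
    rw [ψ.image_succ n] at ih ⊢
    exact ψ.image_succ (n + 1) ▸ pushIdeal_mono _ (ψ.image_succ n ▸ ih)

theorem sigma_eq_image {n : ℕ} (h : ∀ m, n ≤ m → ψ.image m = ψ.image n) :
    ψ.sigma = ψ.image n :=
  le_antisymm (iInf_le _ n) <| le_iInf fun m =>
    (le_total n m).elim (fun hm => (h m hm).ge) (fun hm => ψ.image_antitone hm)

theorem le_sigma {J : Ideal S} (h : J ≤ pushIdeal ψ.onTensor J) : J ≤ ψ.sigma := by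
  refine le_iInf fun n => ?_
  induction n with
  | zero => exact ψ.image_zero ▸ le_top
  | succ n ih => exact ψ.image_succ n ▸ h.trans (pushIdeal_mono _ ih)

end CartierMap

namespace RelCartierMap

section Image

variable {p e : ℕ} [Fact p.Prime] {A R L : Type u} [CommRing A] [InCharP p A]
  [CommRing R] [InCharP p R] [Algebra A R] [AddCommGroup L] [Module A L] [Module R L]
  [IsScalarTower A R L] (φ : RelCartierMap p e A R L) {j k : ℕ}

/-- The map
`(L ⊗_R (R ⊗_A A^{1/p^k}))^{1/p^e} = L^{1/p^e} ⊗_{A^{1/p^e}} A^{1/p^{k+e}} → R ⊗_A A^{1/p^{k+e}}`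
given by `φ ⊗_{A^{1/p^e}} A^{1/p^{k+e}}`, through which the iterates of `φ` are formed. -/
def onTensor (k : ℕ) : L ⊗[R] (R ⊗[A] Root p k A) →+ R ⊗[A] Root p (k + e) A :=
  (LinearMap.baseChange R (frobRoot p k e A)).toAddMonoidHom.comp <|
    (φ.twist (Root p k A)).comp
      (TensorProduct.AlgebraTensorModule.cancelBaseChange A R R L
        (Root p k A)).toAddEquiv.toAddMonoidHom

theorem onTensor_tmul_tmul (l : L) (r : R) (a : Root p k A) :
    φ.onTensor k (l ⊗ₜ (r ⊗ₜ a)) = levelUp p A R (Nat.le_add_left e k) (φ.toAddMonoidHom (r • l)) *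
      ((1 : R) ⊗ₜ toRoot p (k + e) (ofRoot a)) := by
  have h : φ.onTensor k (l ⊗ₜ (r ⊗ₜ a)) = LinearMap.baseChange R (frobRoot p k e A)
      (actOn p e A R a (φ.toAddMonoidHom (r • l))) := rfl
  rw [h]
  generalize φ.toAddMonoidHom (r • l) = t
  induction t with
  | zero => simp only [map_zero, zero_mul]
  | add t t' ht ht' => simp only [map_add, ht, ht', add_mul]
  | tmul r b =>
    rw [levelUp_tmul, Algebra.TensorProduct.tmul_mul_tmul, mul_one, Nat.add_sub_cancel]
    rfl

theorem onTensor_tmul_mul (l : L) (r : R) (a : Root p k A) (t : R ⊗[A] Root p k A) :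
    φ.onTensor k (l ⊗ₜ ((r ⊗ₜ a) * t)) =
      ((1 : R) ⊗ₜ toRoot p (k + e) (ofRoot a)) * φ.onTensor k ((r • l) ⊗ₜ t) := by
  induction t with
  | zero => simp only [mul_zero, TensorProduct.tmul_zero, map_zero]
  | add t t' ht ht' => simp only [mul_add, TensorProduct.tmul_add, map_add, ht, ht']
  | tmul s b =>
    rw [Algebra.TensorProduct.tmul_mul_tmul, onTensor_tmul_tmul, onTensor_tmul_tmul, mul_left_comm,
      Algebra.TensorProduct.tmul_mul_tmul, one_mul, smul_smul, mul_comm s r]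
    rfl

theorem onTensor_pow_smul_tmul (r : R) (a : A) (l : L) (t : R ⊗[A] Root p k A) :
    φ.onTensor k ((r ^ p ^ e • a • l) ⊗ₜ t) =
      (r ⊗ₜ toRoot p (k + e) (a ^ p ^ k)) * φ.onTensor k (l ⊗ₜ t) := by
  induction t with
  | zero => simp only [mul_zero, TensorProduct.tmul_zero, map_zero]
  | add t t' ht ht' => simp only [TensorProduct.tmul_add, map_add, ht, ht', mul_add]
  | tmul s b =>
    have h : φ.toAddMonoidHom (r ^ p ^ e • a • s • l) =
      (r ⊗ₜ[A] toRoot p e a) * φ.toAddMonoidHom (s • l) := φ.map_smul' r a (s • l)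
    rw [onTensor_tmul_tmul, onTensor_tmul_tmul, smul_comm s, smul_comm s a l, h, map_mul,
      mul_assoc, levelUp_tmul, Nat.add_sub_cancel]
    rfl

theorem levelUp_onTensor (h : j ≤ k) (l : L) (t : R ⊗[A] Root p j A) :
    levelUp p A R (Nat.add_le_add_right h e) (φ.onTensor j (l ⊗ₜ t)) =
      φ.onTensor k (l ⊗ₜ levelUp p A R h t) := by
  induction t with
  | zero => simp only [TensorProduct.tmul_zero, map_zero]
  | add t t' ht ht' => simp only [TensorProduct.tmul_add, map_add, ht, ht']
  | tmul s b =>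
    rw [onTensor_tmul_tmul, map_mul, levelUp_levelUp, levelUp_tmul, levelUp_tmul,
      onTensor_tmul_tmul, Nat.add_sub_add_right]
    rfl

theorem isBalanced_onTensor (k : ℕ) : IsBalanced (φ.onTensor k) := fun l s t => by
  induction s with
  | zero => rw [zero_mul, TensorProduct.tmul_zero, map_zero]; exact Ideal.zero_mem _
  | add s s' hs hs' => rw [add_mul, TensorProduct.tmul_add, map_add]; exact Ideal.add_mem _ hs hs'
  | tmul r a =>
    rw [onTensor_tmul_mul]
    exact Ideal.mul_mem_left _ _ (Ideal.subset_span ⟨r • l, rfl⟩)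

theorem pushIdeal_map_levelUp (h : j ≤ k) (J : Ideal (R ⊗[A] Root p j A)) :
    pushIdeal (φ.onTensor k) (J.map (levelUp p A R h)) =
      (pushIdeal (φ.onTensor j) J).map (levelUp p A R (Nat.add_le_add_right h e)) :=
  (φ.isBalanced_onTensor k).pushIdeal_map id (levelUp p A R h).toRingHom
    (levelUp p A R (Nat.add_le_add_right h e)).toRingHom (φ.levelUp_onTensor h)
    (fun l _ => Ideal.subset_span ⟨l, rfl⟩) J

theorem image_zero : φ.image 0 = ⊤ := by
  rw [Ideal.eq_top_iff_one]
  exact Ideal.subset_span ⟨(1 : R), map_one (algebraMap R (R ⊗[A] Root p (e * 0) A))⟩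

theorem image_succ (n : ℕ) : φ.image (n + 1) = pushIdeal (φ.onTensor (e * n)) (φ.image n) :=
  span_range_comp_lTensor (φ.isBalanced_onTensor _) (φ.iter n)

theorem image_succ_le (n : ℕ) :
    φ.image (n + 1) ≤ (φ.image n).map (levelUp p A R (Nat.mul_le_mul_left e n.le_succ)) := by
  induction n with
  | zero =>
    rw [image_zero, Ideal.map_top]
    exact le_top
  | succ n ih =>
    rw [image_succ φ (n + 1), image_succ φ n]
    exact (pushIdeal_mono _ (image_succ φ n ▸ ih)).trans (φ.pushIdeal_map_levelUp _ _).le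

/-- The chain of the images of the iterates of `φ`, compared through `levelUp`, stabilizes at the
`n`-th one. -/
def IsStableAt (n : ℕ) : Prop :=
  φ.image (n + 1) = (φ.image n).map (levelUp p A R (Nat.mul_le_mul_left e n.le_succ))

variable {φ}

theorem IsStableAt.succ {n : ℕ} (h : φ.IsStableAt n) : φ.IsStableAt (n + 1) := by
  have h' := φ.pushIdeal_map_levelUp (Nat.mul_le_mul_left e n.le_succ) (φ.image n)
  rw [← show φ.image (n + 1) = _ from h, ← image_succ, ← image_succ] at h'
  exact h'

theorem IsStableAt.of_le {n m : ℕ} (h : φ.IsStableAt n) (hnm : n ≤ m) : φ.IsStableAt m := by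
  induction m, hnm using Nat.le_induction with
  | base => exact h
  | succ m _ ih => exact ih.succ

end Image

/-! ### Functoriality -/

section Functoriality

variable {p e : ℕ} [Fact p.Prime] {A R L : Type u} [CommRing A] [InCharP p A]
  [CommRing R] [InCharP p R] [Algebra A R] [AddCommGroup L] [Module A L] [Module R L]
  [IsScalarTower A R L] {A' R' L' : Type u} [CommRing A'] [InCharP p A'] [CommRing R']
  [InCharP p R'] [Algebra A' R'] [AddCommGroup L'] [Module A' L'] [Module R' L']
  [IsScalarTower A' R' L'] {k : ℕ}

/-- A morphism from `φ` to `φ'` over a commutative square from `A → R` to `A' → R'`, such that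
`L'^{1/p^e}` is generated over `R' ⊗ A'^{1/p^e}` by the image of `L^{1/p^e}`. Localizations and
base changes are of this kind. -/
structure IsGeneratingMap (φ : RelCartierMap p e A R L) (φ' : RelCartierMap p e A' R' L')
    (g : A →+* A') (h : R →+* R') (hgh : h.comp (algebraMap A R) = (algebraMap A' R').comp g)
    (q : L →+ L') : Prop where
  smul : ∀ (r : R) (l : L), q (r • l) = h r • q l
  comp : ∀ l, φ'.toAddMonoidHom (q l) = relRingMap p e g h hgh (φ.toAddMonoidHom l)
  generates : ∀ l', l' ∈ AddSubmonoid.closure {x | ∃ (r : R') (a : A') (l : L),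
    r ^ p ^ e • a • q l = x}

namespace IsGeneratingMap

variable {φ : RelCartierMap p e A R L} {φ' : RelCartierMap p e A' R' L'} {g : A →+* A'}
  {h : R →+* R'} {hgh : h.comp (algebraMap A R) = (algebraMap A' R').comp g} {q : L →+ L'}

theorem relRingMap_onTensor (H : IsGeneratingMap φ φ' g h hgh q) (l : L)
    (t : R ⊗[A] Root p k A) :
    relRingMap p (k + e) g h hgh (φ.onTensor k (l ⊗ₜ t)) =
      φ'.onTensor k (q l ⊗ₜ relRingMap p k g h hgh t) := by
  induction t with
  | zero => simp only [TensorProduct.tmul_zero, map_zero]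
  | add t t' ht ht' => simp only [TensorProduct.tmul_add, map_add, ht, ht']
  | tmul s b =>
    rw [onTensor_tmul_tmul, map_mul, relRingMap_levelUp, relRingMap_tmul, relRingMap_tmul,
      onTensor_tmul_tmul, ← H.comp, H.smul, map_one]
    rfl

omit [InCharP p R] [IsScalarTower A R L] in
theorem onTensor_mem_span (H : IsGeneratingMap φ φ' g h hgh q) (l' : L')
    (t' : R' ⊗[A'] Root p k A') :
    φ'.onTensor k (l' ⊗ₜ t') ∈ Ideal.span (Set.range fun l => φ'.onTensor k (q l ⊗ₜ t')) := by
  induction H.generates l' using AddSubmonoid.closure_induction with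
  | mem x hx =>
    obtain ⟨r, a, l, rfl⟩ := hx
    rw [onTensor_pow_smul_tmul]
    exact Ideal.mul_mem_left _ _ (Ideal.subset_span ⟨l, rfl⟩)
  | zero => rw [TensorProduct.zero_tmul, map_zero]; exact Ideal.zero_mem _
  | add x y _ _ hx hy => rw [TensorProduct.add_tmul, map_add]; exact Ideal.add_mem _ hx hy

theorem image_eq (H : IsGeneratingMap φ φ' g h hgh q) (n : ℕ) :
    φ'.image n = (φ.image n).map (relRingMap p (e * n) g h hgh) := by
  induction n with
  | zero => rw [image_zero, image_zero, Ideal.map_top]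
  | succ n ih =>
    rw [image_succ, ih, image_succ]
    exact (φ'.isBalanced_onTensor _).pushIdeal_map q _ (relRingMap p (e * n + e) g h hgh)
      H.relRingMap_onTensor H.onTensor_mem_span _

theorem isStableAt (H : IsGeneratingMap φ φ' g h hgh q) {n : ℕ} (hn : φ.IsStableAt n) :
    φ'.IsStableAt n := by
  rw [IsStableAt, H.image_eq, H.image_eq, ← map_relRingMap_map_levelUp,
    ← show φ.image (n + 1) = _ from hn]

end IsGeneratingMap

theorem isGeneratingMap_baseChange (φ : RelCartierMap p e A R L) (B : Type u) [CommRing B]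
    [InCharP p B] [Algebra A B] :
    IsGeneratingMap φ (φ.baseChange B) (algebraMap A B)
      (Algebra.TensorProduct.includeRight : R →ₐ[A] B ⊗[A] R).toRingHom
      (RingHom.ext fun a => by simp)
      (TensorProduct.mk A B L 1).toAddMonoidHom where
  smul r l := by
    change extTmul 1 (r • l) = ((1 : B) ⊗ₜ[A] r) • (extTmul 1 l : ExtTensor A B R B L)
    rw [smul_extTmul, one_smul]
  comp l := by
    change baseChangeHom φ B (extTmul 1 l) = baseRingMap p e A R B (φ.toFun l)
    rw [baseChangeHom_extTmul]
    exact one_mul _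
  generates x := by
    induction x using ext_induction with
    | h0 => exact zero_mem _
    | ha x y hx hy => exact add_mem hx hy
    | ht b l =>
      refine AddSubmonoid.subset_closure ⟨1, b, l, ?_⟩
      rw [one_pow, one_smul]
      change (b ⊗ₜ[A] (1 : R)) • (extTmul 1 l : ExtTensor A B R B L) = _
      rw [smul_extTmul, one_smul, smul_eq_mul, mul_one]

theorem image_baseChange (φ : RelCartierMap p e A R L) (B : Type u) [CommRing B]
    [InCharP p B] [Algebra A B] (n : ℕ) :
    (φ.baseChange B).image n = (φ.image n).map (baseRingMap p (e * n) A R B) :=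
  (isGeneratingMap_baseChange φ B).image_eq n

end Functoriality

end RelCartierMap

/-! ### The images of the iterates of `γ` -/

namespace RelCartierMap

section Gamma

variable {p e : ℕ} [Fact p.Prime] {A R L M : Type u} [CommRing A] [InCharP p A]
  [CommRing R] [Algebra A R] [AddCommGroup L] [Module A L] [Module R L]
  [IsScalarTower A R L] [AddCommGroup M] [Module A M]

/-- The map `A^{1/p^{k+e}} → A^{1/p^k}` given by `a^{1/p^{k+e}} ↦ Ψ(a m)^{1/p^k}`, for `m ∈ M`. When
`Ψ(m) = 1` it is a retraction of the inclusion `A^{1/p^k} → A^{1/p^{k+e}}`. -/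
def evalRoot (Ψ : CartierMap p e A M) (k : ℕ) (m : M) : Root p (k + e) A →ₗ[A] Root p k A where
  toFun a := toRoot p k (Ψ.toAddMonoidHom ((ofRoot a : A) • m))
  map_add' a b := by
    change Ψ.toAddMonoidHom (((ofRoot a : A) + (ofRoot b : A)) • m) = _
    rw [add_smul, map_add]
    rfl
  map_smul' a b := by
    change Ψ.toAddMonoidHom ((a ^ p ^ (k + e) * ofRoot b : A) • m) =
      a ^ p ^ k * Ψ.toAddMonoidHom ((ofRoot b : A) • m)
    rw [pow_add, pow_mul, mul_smul]
    exact Ψ.map_smul' _ _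

theorem baseChange_evalRoot_mul_levelUp (Ψ : CartierMap p e A M) (k : ℕ) (m : M)
    (y : R ⊗[A] Root p (k + e) A) (t : R ⊗[A] Root p k A) :
    (evalRoot Ψ k m).baseChange R (y * levelUp p A R (Nat.le_add_right k e) t) =
      (evalRoot Ψ k m).baseChange R y * t := by
  induction y with
  | zero => simp only [zero_mul, map_zero]
  | add y y' hy hy' => simp only [add_mul, map_add, hy, hy']
  | tmul r a =>
    induction t with
    | zero => simp only [mul_zero, map_zero]
    | add t t' ht ht' => simp only [mul_add, map_add, ht, ht']
    | tmul s b =>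
      rw [levelUp_tmul, Algebra.TensorProduct.tmul_mul_tmul, LinearMap.baseChange_tmul,
        LinearMap.baseChange_tmul, Algebra.TensorProduct.tmul_mul_tmul]
      congr 1
      change Ψ.toAddMonoidHom ((ofRoot a * ofRoot b ^ p ^ (k + e - k) : A) • m) =
        Ψ.toAddMonoidHom ((ofRoot a : A) • m) * ofRoot b
      rw [Nat.add_sub_cancel_left, mul_comm, mul_smul, mul_comm]
      exact Ψ.map_smul' _ _

theorem baseChange_evalRoot_levelUp (Ψ : CartierMap p e A M) (k : ℕ) {m : M}
    (hm : Ψ.toAddMonoidHom m = 1) (t : R ⊗[A] Root p k A) :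
    (evalRoot Ψ k m).baseChange R (levelUp p A R (Nat.le_add_right k e) t) = t := by
  have h : (evalRoot Ψ k m).baseChange R 1 = 1 := by
    rw [Algebra.TensorProduct.one_def, LinearMap.baseChange_tmul, Algebra.TensorProduct.one_def]
    congr 1
    exact (congrArg Ψ.toAddMonoidHom (one_smul A m)).trans hm
  rw [← one_mul (levelUp _ _ _ _ t), baseChange_evalRoot_mul_levelUp, h, one_mul]

theorem baseChange_evalRoot_mem (Ψ : CartierMap p e A M) {k : ℕ} (m : M)
    {I : Ideal (R ⊗[A] Root p k A)} {y : R ⊗[A] Root p (k + e) A}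
    (hy : y ∈ I.map (levelUp p A R (Nat.le_add_right k e))) :
    (evalRoot Ψ k m).baseChange R y ∈ I := by
  induction hy using Submodule.closure_induction with
  | zero => rw [map_zero]; exact I.zero_mem
  | add y y' _ _ hy hy' => rw [map_add]; exact I.add_mem hy hy'
  | smul_mem s y hy =>
    obtain ⟨t, ht, rfl⟩ := hy
    exact (baseChange_evalRoot_mul_levelUp Ψ k m s t).symm ▸ I.mul_mem_left _ ht

theorem baseChange_rootOf_actOn_smul (Ψ : CartierMap p e A M) (k : ℕ) (m : M) (b : Root p k A)
    (t : R ⊗[A] Root p e A) :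
    (rootOf Ψ k).baseChange R (actOn p e A R (b • toFrob p k m) t) =
      (evalRoot Ψ k m).baseChange R (levelUp p A R (Nat.le_add_left e k) t *
        ((1 : R) ⊗ₜ toRoot p (k + e) (ofRoot b))) := by
  induction t with
  | zero => simp only [zero_mul, map_zero]
  | add t t' ht ht' => simp only [map_add, ht, ht', add_mul]
  | tmul s a =>
    rw [levelUp_tmul, Algebra.TensorProduct.tmul_mul_tmul, mul_one, LinearMap.baseChange_tmul]
    change s ⊗ₜ rootOf Ψ k (toFrob p e (ofRoot a • (b • toFrob p k m))) = _
    congr 1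
    change Ψ.toAddMonoidHom ((ofRoot a ^ p ^ k : A) • (ofRoot b : A) • m) =
      Ψ.toAddMonoidHom ((ofRoot a ^ p ^ (k + e - e) * ofRoot b : A) • m)
    rw [Nat.add_sub_cancel, mul_smul]

variable [InCharP p R] (φ : RelCartierMap p e A R L) (Ψ : CartierMap p e A M)

theorem gamma_onTensor_extTmul (n : ℕ) (t : R ⊗[A] Root p (e * n) A) (l : L) (m : M) :
    (φ.gamma Ψ n).onTensor
        ((extTmul l (toFrob p (e * n) m) : GammaSource p e A R L M n) ⊗ₜ t) =
      (evalRoot Ψ (e * n) m).baseChange R (φ.onTensor (e * n) (l ⊗ₜ t)) := by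
  induction t with
  | zero => simp only [TensorProduct.tmul_zero, map_zero]
  | add t t' ht ht' => simp only [TensorProduct.tmul_add, map_add, ht, ht']
  | tmul r b =>
    rw [CartierMap.onTensor_tmul, smul_extTmul, onTensor_tmul_tmul]
    exact baseChange_rootOf_actOn_smul Ψ (e * n) m b _

theorem pushIdeal_gamma_le {n : ℕ} {J I : Ideal (R ⊗[A] Root p (e * n) A)}
    (h : pushIdeal (φ.onTensor (e * n)) J ≤ I.map (levelUp p A R (Nat.le_add_right _ e))) :
    pushIdeal (φ.gamma Ψ n).onTensor J ≤ I := by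
  refine pushIdeal_le.2 fun x t ht => ?_
  induction x using ext_induction with
  | h0 => rw [TensorProduct.zero_tmul, map_zero]; exact I.zero_mem
  | ha x y hx hy => rw [TensorProduct.add_tmul, map_add]; exact I.add_mem hx hy
  | ht l m =>
    exact (φ.gamma_onTensor_extTmul Ψ n t l (ofFrob m)).symm ▸
      baseChange_evalRoot_mem Ψ (ofFrob m) (h (mem_pushIdeal _ l ht))

theorem baseChange_evalRoot_mem_pushIdeal_gamma {n : ℕ} {J : Ideal (R ⊗[A] Root p (e * n) A)}
    (m : M) {y : R ⊗[A] Root p (e * n + e) A} (hy : y ∈ pushIdeal (φ.onTensor (e * n)) J) :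
    (evalRoot Ψ (e * n) m).baseChange R y ∈ pushIdeal (φ.gamma Ψ n).onTensor J := by
  induction hy using Submodule.closure_induction with
  | zero => rw [map_zero]; exact Ideal.zero_mem _
  | add y y' _ _ hy hy' => rw [map_add]; exact Ideal.add_mem _ hy hy'
  | smul_mem s y hy =>
    obtain ⟨l, t, ht, rfl⟩ := hy
    induction s with
    | zero => rw [zero_smul, map_zero]; exact Ideal.zero_mem _
    | add s s' hs hs' => rw [add_smul, map_add]; exact Ideal.add_mem _ hs hs'
    | tmul r a =>
      have h : (r ⊗ₜ a : R ⊗[A] Root p (e * n + e) A) • φ.onTensor (e * n) (l ⊗ₜ t) =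
          φ.onTensor (e * n)
            ((r ^ p ^ e • l) ⊗ₜ (((1 : R) ⊗ₜ toRoot p (e * n) (ofRoot a)) * t)) := by
        rw [onTensor_tmul_mul, one_smul, ← one_smul A l, onTensor_pow_smul_tmul, one_pow,
          ← mul_assoc, Algebra.TensorProduct.tmul_mul_tmul, one_mul, one_smul]
        congr 2
        exact (mul_one _).symm
      rw [h, ← gamma_onTensor_extTmul]
      exact mem_pushIdeal _ _ (J.mul_mem_left _ ht)

theorem image_gamma_le {n m : ℕ} (h : m ≤ n) :
    (φ.gamma Ψ n).image m ≤ (φ.image m).map (levelUp p A R (Nat.mul_le_mul_left e h)) := by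
  induction m with
  | zero => rw [image_zero, Ideal.map_top]; exact le_top
  | succ m ih =>
    rw [CartierMap.image_succ]
    refine φ.pushIdeal_gamma_le Ψ ((pushIdeal_mono _ (ih (Nat.le_of_succ_le h))).trans ?_)
    rw [pushIdeal_map_levelUp, ← image_succ, map_levelUp_map_levelUp]

theorem image_le_pushIdeal_gamma {n : ℕ} (h : φ.IsStableAt n) {m : M}
    (hm : Ψ.toAddMonoidHom m = 1) :
    φ.image n ≤ pushIdeal (φ.gamma Ψ n).onTensor (φ.image n) := by
  intro t ht
  have mem_push : levelUp p A R (Nat.le_add_right _ e) t ∈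
      pushIdeal (φ.onTensor (e * n)) (φ.image n) := by
    rw [← image_succ, show φ.image (n + 1) = _ from h]
    exact Ideal.mem_map_of_mem _ ht
  have := φ.baseChange_evalRoot_mem_pushIdeal_gamma Ψ m mem_push
  rwa [baseChange_evalRoot_levelUp Ψ _ hm] at this

theorem sigma_gamma_eq_image {n : ℕ} (h : φ.IsStableAt n) {m : M}
    (hm : Ψ.toAddMonoidHom m = 1) : (φ.gamma Ψ n).sigma = φ.image n := by
  apply le_antisymm
  · exact (iInf_le _ n).trans ((φ.image_gamma_le Ψ le_rfl).trans (map_levelUp_refl _).le)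
  · exact CartierMap.le_sigma _ (φ.image_le_pushIdeal_gamma Ψ h hm)

end Gamma

/-! ### Perfect base fields -/

section PerfectField

variable {p e : ℕ} [Fact p.Prime] {K R L : Type u} [Field K] [CharP K p] [PerfectRing K p]
  [CommRing R] [Algebra K R]

theorem algebraMap_rid_perfectRoot (t : R ⊗[K] Root p e K) :
    algebraMap R (R ⊗[K] Root p e K) (TensorProduct.AlgebraTensorModule.rid K R R
      ((perfectRoot p e K).baseChange R t)) = t := by
  induction t with
  | zero => simp only [map_zero]
  | add t t' ht ht' => simp only [map_add, ht, ht']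
  | tmul r a =>
    rw [LinearMap.baseChange_tmul, TensorProduct.AlgebraTensorModule.rid_tmul,
      Algebra.TensorProduct.algebraMap_apply, Algebra.algebraMap_self_apply,
      TensorProduct.smul_tmul]
    congr 1
    change ((iterateFrobeniusEquiv K p e).symm (ofRoot a)) ^ p ^ e * 1 = ofRoot a
    rw [mul_one]
    exact (iterateFrobeniusEquiv K p e).apply_symm_apply (ofRoot a)

theorem bijective_algebraMap_tensor_root (R : Type u) [CommRing R] [Algebra K R] (k : ℕ) :
    Function.Bijective (algebraMap R (R ⊗[K] Root p k K)) :=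
  Algebra.TensorProduct.includeLeft_bijective (S := R) (iterateFrobeniusEquiv K p k).bijective

variable [AddCommGroup L] [Module K L] [Module R L] [IsScalarTower K R L]
  (φ : RelCartierMap p e K R L)

theorem algebraMap_toAbsolute (l : L) :
    algebraMap R (R ⊗[K] Root p e K) (φ.toAbsolute.toAddMonoidHom l) = φ.toAddMonoidHom l :=
  algebraMap_rid_perfectRoot _

variable [InCharP p R]

theorem algebraMap_toAbsolute_onTensor (k : ℕ) (l : L) (r : R) :
    algebraMap R (R ⊗[K] Root p (k + e) K) (φ.toAbsolute.onTensor (l ⊗ₜ r)) =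
      φ.onTensor k (l ⊗ₜ algebraMap R (R ⊗[K] Root p k K) r) := by
  have h : algebraMap R (R ⊗[K] Root p k K) r = r ⊗ₜ 1 := rfl
  rw [h, onTensor_tmul_tmul, ← algebraMap_toAbsolute, AlgHom.commutes]
  exact (mul_one _).symm

theorem image_eq_map_toAbsolute (n : ℕ) :
    φ.image n = (φ.toAbsolute.image n).map (algebraMap R (R ⊗[K] Root p (e * n) K)) := by
  induction n with
  | zero => rw [image_zero, CartierMap.image_zero, Ideal.map_top]
  | succ n ih =>
    rw [image_succ, ih, CartierMap.image_succ]
    exact (φ.isBalanced_onTensor _).pushIdeal_map id _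
      (algebraMap R (R ⊗[K] Root p (e * n + e) K)) (φ.algebraMap_toAbsolute_onTensor _)
      (fun l _ => Ideal.subset_span ⟨l, rfl⟩) _

theorem isStableAt_iff_toAbsolute (n : ℕ) :
    φ.IsStableAt n ↔ φ.toAbsolute.image (n + 1) = φ.toAbsolute.image n := by
  have map_algebraMap (J : Ideal R) : (J.map (algebraMap R (R ⊗[K] Root p (e * n) K))).map
      (levelUp p K R (Nat.mul_le_mul_left e n.le_succ)) = J.map (algebraMap R _) := by
    change (J.map _).map (levelUp p K R _).toRingHom = _
    rw [Ideal.map_map]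
    exact congrArg (J.map ·) (levelUp p K R _).comp_algebraMap
  rw [IsStableAt, image_eq_map_toAbsolute, image_eq_map_toAbsolute, map_algebraMap]
  exact (Function.LeftInverse.injective fun J =>
    Ideal.comap_map_of_bijective _ (bijective_algebraMap_tensor_root R _)).eq_iff

theorem map_sigma_toAbsolute {n : ℕ} (h : φ.IsStableAt n) :
    φ.toAbsolute.sigma.map (algebraMap R (R ⊗[K] Root p (e * n) K)) = φ.image n := by
  have stable (m : ℕ) (hm : n ≤ m) : φ.toAbsolute.image m = φ.toAbsolute.image n := by
    induction m, hm using Nat.le_induction with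
    | base => rfl
    | succ m hm ih => exact ((φ.isStableAt_iff_toAbsolute m).1 (h.of_le hm)).trans ih
  rw [image_eq_map_toAbsolute, φ.toAbsolute.sigma_eq_image stable]

end PerfectField

end RelCartierMap

/-! ### Spreading out -/

section SpreadingOut

theorem exists_ringHom_tensorProduct {A R B T : Type*} [CommRing A] [CommRing R] [CommRing B]
    [CommRing T] [Algebra A R] [Algebra A B] (β : R →+* T) (α : B →+* T)
    (h : ∀ a, β (algebraMap A R a) = α (algebraMap A B a)) :
    ∃ χ : R ⊗[A] B →+* T, ∀ r b, χ (r ⊗ₜ b) = β r * α b := by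
  let : Algebra A T := (β.comp (algebraMap A R)).toAlgebra
  let β' : R →ₐ[A] T := { β with commutes' := fun _ => rfl }
  let α' : B →ₐ[A] T := { α with commutes' := fun a => (h a).symm }
  exact ⟨(Algebra.TensorProduct.lift β' α' (fun _ _ => Commute.all _ _)).toRingHom, fun r b => rfl⟩

theorem flat_of_injective_algebraMap {A K : Type*} [CommRing A] [IsDomain A] [Field K]
    [Algebra A K] (hK : Function.Injective (algebraMap A K)) : Module.Flat A K := by
  have : FaithfulSMul A K := (faithfulSMul_iff_algebraMap_injective A K).2 hK
  let : Algebra (FractionRing A) K := FractionRing.liftAlgebra A K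
  have : Module.Flat A (FractionRing A) := IsLocalization.flat _ (nonZeroDivisors A)
  exact Module.Flat.trans A (FractionRing A) K

theorem exists_ne_zero_smul_eq_zero {A K Q : Type*} [CommRing A] [CommRing K] [Nontrivial K]
    [Algebra A K] [Module.Flat A K] [AddCommGroup Q] [Module A Q] {q : Q}
    (hq : (1 : K) ⊗ₜ[A] q = 0) : ∃ a : A, a ≠ 0 ∧ a • q = 0 := by
  by_contra! H
  have injective_smul : Function.Injective (LinearMap.toSpanSingleton A Q q) :=
    (injective_iff_map_eq_zero _).2 fun a ha => by
      by_contra h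
      exact H a h ha
  have one_tmul_one : (1 : K) ⊗ₜ[A] (1 : A) = 0 :=
    Module.Flat.lTensor_preserves_injective_linearMap (M := K) _ injective_smul (by simp [hq])
  have := congrArg (TensorProduct.rid A K) one_tmul_one
  simp at this

variable {p : ℕ} [Fact p.Prime] {A R : Type u} [CommRing A] [InCharP p A] [CommRing R]
  [Algebra A R] {k : ℕ}

theorem isNoetherianRing_tensor_root [IsNoetherianRing A] [Algebra.FiniteType A R] (k : ℕ) :
    IsNoetherianRing (R ⊗[A] Root p k A) := by
  have : IsNoetherianRing (Root p k A) := inferInstanceAs (IsNoetherianRing A)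
  have : IsNoetherianRing (Root p k A ⊗[A] R) :=
    Algebra.FiniteType.isNoetherianRing (Root p k A) _
  exact isNoetherianRing_of_ringEquiv _ (Algebra.TensorProduct.comm A (Root p k A) R).toRingEquiv

theorem map_mk_eq_zero_of_relRingMap_mem {A' R' T : Type*} [CommRing A'] [InCharP p A']
    [CommRing R'] [Algebra A' R'] [CommRing T] {g : A →+* A'} {h : R →+* R'}
    {hgh : h.comp (algebraMap A R) = (algebraMap A' R').comp g} {J : Ideal (R ⊗[A] Root p k A)}
    (ρ : (R ⊗[A] Root p k A) ⧸ J →+* T) (β : R' →+* T) (α : Root p k A' →+* T)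
    (hβα : ∀ a', β (algebraMap A' R' a') = α (algebraMap A' (Root p k A') a'))
    (hβ : ∀ r, β (h r) = ρ (Ideal.Quotient.mk J (r ⊗ₜ 1)))
    (hα : ∀ a, α (rootMap p k g a) = ρ (Ideal.Quotient.mk J (1 ⊗ₜ a))) {x : R ⊗[A] Root p k A}
    (hx : relRingMap p k g h hgh x ∈ J.map (relRingMap p k g h hgh)) :
    ρ (Ideal.Quotient.mk J x) = 0 := by
  obtain ⟨χ, hχ⟩ := exists_ringHom_tensorProduct β α hβα
  have factor (s : R ⊗[A] Root p k A) :
      χ (relRingMap p k g h hgh s) = ρ (Ideal.Quotient.mk J s) := by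
    induction s with
    | zero => simp only [map_zero]
    | add s t hs ht => simp only [map_add, hs, ht]
    | tmul r a =>
      have hα' : α (toRoot p k (g (ofRoot a))) = ρ (Ideal.Quotient.mk J (1 ⊗ₜ a)) := hα a
      rw [relRingMap_tmul, hχ, hβ, hα', ← map_mul, ← map_mul, Algebra.TensorProduct.tmul_mul_tmul,
        mul_one, one_mul]
  have map_le : J.map (relRingMap p k g h hgh) ≤ RingHom.ker χ :=
    Ideal.map_le_iff_le_comap.2 fun y hy => (factor y).trans <| by
      rw [Ideal.Quotient.eq_zero_iff_mem.2 hy, map_zero]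
  exact (factor x).symm.trans (map_le hx)

theorem map_mk_eq_zero_of_baseRingMap_mem {K T : Type*} [CommRing K] [InCharP p K] [Algebra A K]
    [CommRing T] {J : Ideal (R ⊗[A] Root p k A)} (ρ : (R ⊗[A] Root p k A) ⧸ J →+* T)
    (α : Root p k K →+* T)
    (hα : ∀ a, α (rootMap p k (algebraMap A K) a) = ρ (Ideal.Quotient.mk J (1 ⊗ₜ a)))
    {x : R ⊗[A] Root p k A} (hx : baseRingMap p k A R K x ∈ J.map (baseRingMap p k A R K)) :
    ρ (Ideal.Quotient.mk J x) = 0 := by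
  obtain ⟨β, hβ⟩ := exists_ringHom_tensorProduct (A := A) (α.comp (algebraMap K (Root p k K)))
    ((ρ.comp (Ideal.Quotient.mk J)).comp (algebraMap R (R ⊗[A] Root p k A))) fun a => by
      have h₁ : algebraMap R (R ⊗[A] Root p k A) (algebraMap A R a) =
        1 ⊗ₜ algebraMap A (Root p k A) a := Algebra.TensorProduct.tmul_one_eq_one_tmul a
      rw [RingHom.comp_apply, RingHom.comp_apply, h₁, RingHom.comp_apply, ← hα]
      exact congrArg α (map_pow (algebraMap A K) a _).symm
  refine map_mk_eq_zero_of_relRingMap_mem ρ β α (fun a' => ?_) (fun r => ?_) hα hx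
  · rw [Algebra.TensorProduct.algebraMap_apply, hβ, map_one, mul_one]
    rfl
  · change β (1 ⊗ₜ r) = _
    rw [hβ, map_one, one_mul]
    rfl

theorem exists_mul_mem_of_baseRingMap_mem [IsDomain A] {K : Type*} [Field K] [InCharP p K]
    [Algebra A K] (hK : Function.Injective (algebraMap A K)) {J : Ideal (R ⊗[A] Root p k A)}
    {x : R ⊗[A] Root p k A} (hx : baseRingMap p k A R K x ∈ J.map (baseRingMap p k A R K)) :
    ∃ a : A, a ≠ 0 ∧ ((1 : R) ⊗ₜ[A] toRoot p k a) * x ∈ J := by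
  let Q := (R ⊗[A] Root p k A) ⧸ J
  let : Algebra (Root p k A) (Root p k K) := (rootMap p k (algebraMap A K)).toAlgebra
  let : Algebra (Root p k A) Q := ((Ideal.Quotient.mk J).comp
    (Algebra.TensorProduct.includeRight : Root p k A →ₐ[A] R ⊗[A] Root p k A).toRingHom).toAlgebra
  have one_tmul_mk : (1 : Root p k K) ⊗ₜ[Root p k A] Ideal.Quotient.mk J x = 0 :=
    map_mk_eq_zero_of_baseRingMap_mem (T := Root p k K ⊗[Root p k A] Q)
      (Algebra.TensorProduct.includeRight : Q →ₐ[Root p k A] _).toRingHom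
      Algebra.TensorProduct.includeLeftRingHom
      (fun a => Algebra.TensorProduct.tmul_one_eq_one_tmul (R := Root p k A) (A := Root p k K)
        (B := Q) a) hx
  have : Nontrivial (Root p k K) := inferInstanceAs (Nontrivial K)
  have : Module.Flat (Root p k A) (Root p k K) :=
    @flat_of_injective_algebraMap A K _ _ _ (algebraMap A K).toAlgebra hK
  obtain ⟨a, ha, smul_eq_zero⟩ := exists_ne_zero_smul_eq_zero one_tmul_mk
  refine ⟨ofRoot a, ha, ?_⟩
  rw [Algebra.smul_def] at smul_eq_zero
  exact Ideal.Quotient.eq_zero_iff_mem.1 ((map_mul (Ideal.Quotient.mk J) _ _).trans smul_eq_zero)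

theorem exists_mul_mem_of_map_baseRingMap_le [IsDomain A] {K : Type u} [Field K] [InCharP p K]
    [Algebra A K] (hK : Function.Injective (algebraMap A K)) [IsNoetherianRing A]
    [Algebra.FiniteType A R] {I J : Ideal (R ⊗[A] Root p k A)}
    (h : I.map (baseRingMap p k A R K) ≤ J.map (baseRingMap p k A R K)) :
    ∃ a : A, a ≠ 0 ∧ ∀ x ∈ I, ((1 : R) ⊗ₜ[A] toRoot p k a) * x ∈ J := by
  have := isNoetherianRing_tensor_root (p := p) (A := A) (R := R) k
  obtain ⟨s, rfl⟩ := (isNoetherianRing_iff_ideal_fg _).1 this I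
  have exists_mul_mem (x) (hx : x ∈ s) :
      ∃ a : A, a ≠ 0 ∧ ((1 : R) ⊗ₜ[A] toRoot p k a) * x ∈ J :=
    exists_mul_mem_of_baseRingMap_mem hK (h (Ideal.mem_map_of_mem _ (Ideal.subset_span hx)))
  choose! a ha mul_mem using exists_mul_mem
  refine ⟨∏ x ∈ s, a x, Finset.prod_ne_zero_iff.2 ha, fun x hx => ?_⟩
  induction hx using Submodule.span_induction with
  | mem x hx =>
    obtain ⟨b, hb⟩ := Finset.dvd_prod_of_mem a hx
    have tmul_prod : ((1 : R) ⊗ₜ[A] toRoot p k (∏ x ∈ s, a x)) =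
        ((1 : R) ⊗ₜ[A] toRoot p k b) * ((1 : R) ⊗ₜ[A] toRoot p k (a x)) := by
      rw [Algebra.TensorProduct.tmul_mul_tmul, one_mul, hb, mul_comm]
      rfl
    rw [tmul_prod, mul_assoc]
    exact Ideal.mul_mem_left _ _ (mul_mem x hx)
  | zero => rw [mul_zero]; exact Ideal.zero_mem _
  | add x y _ _ hx hy => rw [mul_add]; exact Ideal.add_mem _ hx hy
  | smul s x _ hx => rw [smul_eq_mul, mul_left_comm]; exact Ideal.mul_mem_left _ _ hx

theorem exists_pow_smul_mem_of_relRingMap_mem {A' R' : Type*} [CommRing A'] [InCharP p A']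
    [CommRing R'] [Algebra A' R'] {g : A →+* A'} (hg : Function.Bijective g) {h : R →+* R'}
    {hgh : h.comp (algebraMap A R) = (algebraMap A' R').comp g} (r : R)
    (hloc : letI := h.toAlgebra; IsLocalization.Away r R') {J : Ideal (R ⊗[A] Root p k A)}
    {x : R ⊗[A] Root p k A} (hx : relRingMap p k g h hgh x ∈ J.map (relRingMap p k g h hgh)) :
    ∃ N : ℕ, r ^ N • x ∈ J := by
  let := h.toAlgebra
  let c : R →+* (R ⊗[A] Root p k A) ⧸ J :=
    (Ideal.Quotient.mk J).comp (algebraMap R (R ⊗[A] Root p k A))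
  let ρ : (R ⊗[A] Root p k A) ⧸ J →+* Localization.Away (c r) := algebraMap _ _
  have isUnit_r : IsUnit (ρ.comp c r) := IsLocalization.Away.algebraMap_isUnit (c r)
  let β : R' →+* Localization.Away (c r) := IsLocalization.Away.lift r isUnit_r
  have hβ (s : R) : β (h s) = ρ (Ideal.Quotient.mk J (s ⊗ₜ 1)) :=
    IsLocalization.Away.lift_eq r isUnit_r s
  let g' := RingEquiv.ofBijective g hg
  let α : Root p k A' →+* Localization.Away (c r) :=
    ((ρ.comp (Ideal.Quotient.mk J)).comp (Algebra.TensorProduct.includeRight :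
      Root p k A →ₐ[A] R ⊗[A] Root p k A).toRingHom).comp (rootMap p k (g'.symm : A' →+* A))
  have hα (a : Root p k A) : α (rootMap p k g a) = ρ (Ideal.Quotient.mk J (1 ⊗ₜ a)) :=
    congrArg (fun b : A => ρ (Ideal.Quotient.mk J (1 ⊗ₜ toRoot p k b))) (g'.symm_apply_apply a)
  have hβα (a' : A') : β (algebraMap A' R' a') = α (algebraMap A' (Root p k A') a') := by
    obtain ⟨a, rfl⟩ := hg.2 a'
    have h₁ : algebraMap A' R' (g a) = h (algebraMap A R a) := (RingHom.congr_fun hgh a).symm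
    have h₂ : algebraMap A' (Root p k A') (g a) = rootMap p k g (algebraMap A (Root p k A) a) :=
      (map_pow g a _).symm
    rw [h₁, h₂, hβ, hα]
    exact congrArg (fun t => ρ (Ideal.Quotient.mk J t))
      (Algebra.TensorProduct.tmul_one_eq_one_tmul a)
  obtain ⟨⟨_, N, rfl⟩, hN⟩ :=
    (IsLocalization.map_eq_zero_iff (Submonoid.powers (c r)) _ _).1
      (map_mk_eq_zero_of_relRingMap_mem ρ β α hβα hβ hα hx)
  refine ⟨N, ?_⟩
  rw [Algebra.smul_def, ← Ideal.Quotient.eq_zero_iff_mem, map_mul, map_pow, map_pow]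
  exact hN

end SpreadingOut

namespace RelCartierMap

variable {p e : ℕ} [Fact p.Prime] {A R L : Type u} [CommRing A] [InCharP p A]
  [CommRing R] [InCharP p R] [Algebra A R] [AddCommGroup L] [Module A L] [Module R L]
  [IsScalarTower A R L] {φ : RelCartierMap p e A R L} {n : ℕ}

theorem exists_mul_mem_of_isStableAt_baseChange [IsDomain A] {K : Type u} [Field K] [InCharP p K]
    [Algebra A K] (hK : Function.Injective (algebraMap A K)) [IsNoetherianRing A]
    [Algebra.FiniteType A R] (h : (φ.baseChange K).IsStableAt n) :
    ∃ a : A, a ≠ 0 ∧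
      ∀ x ∈ (φ.image n).map (levelUp p A R (Nat.mul_le_mul_left e n.le_succ)),
        ((1 : R) ⊗ₜ[A] toRoot p (e * (n + 1)) a) * x ∈ φ.image (n + 1) := by
  refine exists_mul_mem_of_map_baseRingMap_le hK ?_
  rw [← image_baseChange, show (φ.baseChange K).image (n + 1) = _ from h, image_baseChange]
  exact (map_relRingMap_map_levelUp _ _ _ _ _).le

theorem isStableAt_of_forall_exists_pow {s : Set R} (hs : Ideal.span s = ⊤)
    (h : ∀ r ∈ s, ∀ x ∈ (φ.image n).map (levelUp p A R (Nat.mul_le_mul_left e n.le_succ)),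
      ∃ N : ℕ, r ^ N • x ∈ φ.image (n + 1)) : φ.IsStableAt n :=
  le_antisymm (φ.image_succ_le n) fun x hx =>
    Submodule.mem_of_span_eq_top_of_smul_pow_mem ((φ.image (n + 1)).restrictScalars R) s hs x
      fun r => h r r.2 x hx

namespace IsGeneratingMap

variable {A' R' L' : Type u} [CommRing A'] [InCharP p A'] [CommRing R'] [InCharP p R']
  [Algebra A' R'] [AddCommGroup L'] [Module A' L'] [Module R' L'] [IsScalarTower A' R' L']
  {φ' : RelCartierMap p e A' R' L'} {g : A →+* A'} {h : R →+* R'}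
  {hgh : h.comp (algebraMap A R) = (algebraMap A' R').comp g} {q : L →+ L'}

theorem isStableAt_of_isUnit (H : IsGeneratingMap φ φ' g h hgh q) {a : A} (ha : IsUnit (g a))
    (hn : ∀ x ∈ (φ.image n).map (levelUp p A R (Nat.mul_le_mul_left e n.le_succ)),
      ((1 : R) ⊗ₜ[A] toRoot p (e * (n + 1)) a) * x ∈ φ.image (n + 1)) :
    φ'.IsStableAt n := by
  refine le_antisymm (φ'.image_succ_le n) ?_
  rw [H.image_eq, H.image_eq, ← map_relRingMap_map_levelUp]
  refine Ideal.map_le_iff_le_comap.2 fun x hx => ?_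
  have mul_mem := Ideal.mem_map_of_mem (relRingMap p (e * (n + 1)) g h hgh) (hn x hx)
  rw [map_mul, relRingMap_tmul, map_one] at mul_mem
  exact (Ideal.unit_mul_mem_iff_mem _ (ha.map (Algebra.TensorProduct.includeRight :
    Root p (e * (n + 1)) A' →ₐ[A'] R' ⊗[A'] Root p (e * (n + 1)) A'))).1 mul_mem

theorem exists_pow_smul_mem (H : IsGeneratingMap φ φ' g h hgh q) (hg : Function.Bijective g)
    (r : R) (hloc : letI := h.toAlgebra; IsLocalization.Away r R') (hn : φ'.IsStableAt n)
    {x : R ⊗[A] Root p (e * (n + 1)) A}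
    (hx : x ∈ (φ.image n).map (levelUp p A R (Nat.mul_le_mul_left e n.le_succ))) :
    ∃ N : ℕ, r ^ N • x ∈ φ.image (n + 1) := by
  refine exists_pow_smul_mem_of_relRingMap_mem hg r hloc (hgh := hgh) ?_
  rw [← H.image_eq, show φ'.image (n + 1) = _ from hn, H.image_eq, ← map_relRingMap_map_levelUp]
  exact Ideal.mem_map_of_mem _ hx

end IsGeneratingMap

end RelCartierMap

/-! ### Sections of line bundles over affine open sets -/

section Sections

/-- Restriction of functions. -/
def funRes {X : Scheme.{u}} {U' U : X.Opens} (h : U' ≤ U) : Γ(X, U) →+* Γ(X, U') :=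
  (X.presheaf.map (homOfLE h).op).hom

/-- Restriction of sections of a sheaf of modules. -/
def secRes {X : Scheme.{u}} (L : X.Modules) {U' U : X.Opens} (h : U' ≤ U) :
    Γ(L, U) →+ Γ(L, U') :=
  (L.presheaf.map (homOfLE h).op).hom

variable {X : Scheme.{u}} {L : X.Modules} {U U' U'' : X.Opens}

theorem funRes_funRes (h : U' ≤ U) (h' : U'' ≤ U') (r : Γ(X, U)) :
    funRes h' (funRes h r) = funRes (h'.trans h) r := by
  change (X.presheaf.map _ ≫ X.presheaf.map _).hom r = _
  rw [← X.presheaf.map_comp]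
  rfl

theorem funRes_self (r : Γ(X, U)) : funRes le_rfl r = r := by
  change (X.presheaf.map (𝟙 _)).hom r = r
  rw [X.presheaf.map_id]
  rfl

theorem secRes_secRes (h : U' ≤ U) (h' : U'' ≤ U') (l : Γ(L, U)) :
    secRes L h' (secRes L h l) = secRes L (h'.trans h) l := by
  change (L.presheaf.map _ ≫ L.presheaf.map _).hom l = _
  rw [← L.presheaf.map_comp]
  rfl

theorem secRes_self (l : Γ(L, U)) : secRes L le_rfl l = l := by
  change (L.presheaf.map (𝟙 _)).hom l = l
  rw [L.presheaf.map_id]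
  rfl

theorem secRes_smul (h : U' ≤ U) (r : Γ(X, U)) (l : Γ(L, U)) :
    secRes L h (r • l) = funRes h r • secRes L h l :=
  L.map_smul _ r l

theorem secRes_ext {ι : Type u} (D : ι → X.Opens) (hD : ∀ i, D i ≤ U) (hcover : U ≤ iSup D)
    {l l' : Γ(L, U)} (h : ∀ i, secRes L (hD i) l = secRes L (hD i) l') : l = l' :=
  TopCat.Sheaf.eq_of_locally_eq' ⟨L.presheaf, L.isSheaf⟩ D U (fun i => homOfLE (hD i)) hcover l l' h

theorem exists_secRes_eq {ι : Type u} (D : ι → X.Opens) (hD : ∀ i, D i ≤ U) (hcover : U ≤ iSup D)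
    (l : ∀ i, Γ(L, D i)) (h : ∀ i j, secRes L (inf_le_left : D i ⊓ D j ≤ D i) (l i) =
      secRes L (inf_le_right : D i ⊓ D j ≤ D j) (l j)) :
    ∃ s : Γ(L, U), ∀ i, secRes L (hD i) s = l i :=
  (TopCat.Sheaf.existsUnique_gluing' ⟨L.presheaf, L.isSheaf⟩ D U (fun i => homOfLE (hD i)) hcover l
    h).exists

theorem exists_secRes_eq_pow_smul {ι : Type u} [Finite ι] {D : ι → X.Opens} (hD : ∀ i, D i ≤ U)
    (hcover : U ≤ iSup D) (h : Γ(X, U)) (l : ∀ i, Γ(L, D i))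
    (agree : ∀ i j, ∀ᶠ N in Filter.atTop,
      funRes (inf_le_left.trans (hD i) : D i ⊓ D j ≤ U) h ^ N • secRes L inf_le_left (l i) =
        funRes (inf_le_left.trans (hD i) : D i ⊓ D j ≤ U) h ^ N •
          secRes L (inf_le_right : D i ⊓ D j ≤ D j) (l j)) :
    ∃ (N : ℕ) (l₀ : Γ(L, U)), ∀ i, secRes L (hD i) l₀ = funRes (hD i) h ^ N • l i := by
  obtain ⟨N, hN⟩ := (Filter.eventually_all.2 fun i => Filter.eventually_all.2 (agree i)).exists
  exact ⟨N, exists_secRes_eq D hD hcover _ fun i j => by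
    simpa only [secRes_smul, map_pow, funRes_funRes] using hN i j⟩

theorem isLocalization_funRes (hU : IsAffineOpen U) (h : Γ(X, U)) {E : X.Opens}
    (hE : X.basicOpen h = E) (hEU : E ≤ U) :
    letI := (funRes hEU).toAlgebra
    IsLocalization.Away h Γ(X, E) := by
  subst hE
  exact hU.isLocalization_basicOpen h

theorem isUnit_funRes_of_le_basicOpen (r : Γ(X, U)) (h : U' ≤ U) (hr : U' ≤ X.basicOpen r) :
    IsUnit (funRes h r) := by
  have isUnit_basicOpen : IsUnit (funRes (X.basicOpen_le r) r) :=
    RingedSpace.isUnit_res_basicOpen X.toRingedSpace r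
  simpa only [funRes_funRes] using isUnit_basicOpen.map (funRes hr)

/-- The section `s` trivializes `L` over `U`: it is a basis of `L` over every smaller open set. -/
def Trivializes (L : X.Modules) (s : Γ(L, U)) : Prop :=
  ∀ (U' : X.Opens) (h : U' ≤ U), Function.Bijective fun r : Γ(X, U') => r • secRes L h s

namespace Trivializes

variable {s : Γ(L, U)}

theorem mono (hs : Trivializes L s) (h : U' ≤ U) : Trivializes L (secRes L h s) := fun U'' h' => by
  simp only [secRes_secRes]
  exact hs U'' _

theorem eventually_exists_pow_smul (hs : Trivializes L s) (hU : IsAffineOpen U) (h : Γ(X, U))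
    {E : X.Opens} (hE : X.basicOpen h = E) (hEU : E ≤ U) (l' : Γ(L, E)) :
    ∀ᶠ N in Filter.atTop, ∃ l : Γ(L, U), secRes L hEU l = funRes hEU h ^ N • l' := by
  let : Algebra Γ(X, U) Γ(X, E) := (funRes hEU).toAlgebra
  have := isLocalization_funRes hU h hE hEU
  obtain ⟨r', rfl⟩ := (hs E hEU).2 l'
  obtain ⟨N, r, hr : r' * funRes hEU h ^ N = funRes hEU r⟩ := IsLocalization.Away.surj h r'
  filter_upwards [Filter.eventually_ge_atTop N] with M hM
  obtain ⟨M, rfl⟩ := Nat.exists_eq_add_of_le hM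
  refine ⟨(h ^ M * r) • s, ?_⟩
  rw [secRes_smul, map_mul, ← hr, smul_smul, map_pow]
  congr 1
  ring

theorem eventually_pow_smul_eq (hs : Trivializes L s) (hU : IsAffineOpen U) (h : Γ(X, U))
    {E : X.Opens} (hE : X.basicOpen h = E) (hEU : E ≤ U) {l l' : Γ(L, U)}
    (hl : secRes L hEU l = secRes L hEU l') : ∀ᶠ N in Filter.atTop, h ^ N • l = h ^ N • l' := by
  let : Algebra Γ(X, U) Γ(X, E) := (funRes hEU).toAlgebra
  have := isLocalization_funRes hU h hE hEU
  have surjective_smul : Function.Surjective fun r : Γ(X, U) => r • s := by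
    simpa only [secRes_self] using (hs U le_rfl).2
  obtain ⟨r, rfl⟩ := surjective_smul l
  obtain ⟨r', rfl⟩ := surjective_smul l'
  rw [secRes_smul, secRes_smul] at hl
  obtain ⟨⟨_, N, rfl⟩, hN : h ^ N * r = h ^ N * r'⟩ :=
    (IsLocalization.eq_iff_exists (Submonoid.powers h) Γ(X, E)).1 ((hs E hEU).1 hl)
  filter_upwards [Filter.eventually_ge_atTop N] with M hM
  obtain ⟨M, rfl⟩ := Nat.exists_eq_add_of_le' hM
  rw [smul_smul, smul_smul, pow_add, mul_assoc, hN, mul_assoc]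

end Trivializes

namespace IsLineBundle

theorem exists_finset_trivializes (hL : IsLineBundle L) (hU : IsAffineOpen U) :
    ∃ t : Finset Γ(X, U), (∀ g ∈ t, ∃ s : Γ(L, X.basicOpen g), Trivializes L s) ∧
      Ideal.span (t : Set Γ(X, U)) = ⊤ := by
  have span_eq_top :
      Ideal.span {g : Γ(X, U) | ∃ s : Γ(L, X.basicOpen g), Trivializes L s} = ⊤ := by
    rw [← hU.self_le_iSup_basicOpen_iff]
    intro x hx
    obtain ⟨O, hxO, s, hs⟩ := hL x
    obtain ⟨g, hg, hxg⟩ := hU.exists_basicOpen_le ⟨x, hxO⟩ hx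
    exact Opens.mem_iSup.2 ⟨⟨g, secRes L hg s, Trivializes.mono (s := s) hs hg⟩, hxg⟩
  obtain ⟨t, ht, ht'⟩ := (Ideal.span_eq_top_iff_finite _).1 span_eq_top
  exact ⟨t, fun g hg => ht hg, ht'⟩

theorem exists_pow_smul_eq (hL : IsLineBundle L) (hU : IsAffineOpen U) (h : Γ(X, U))
    {E : X.Opens} (hE : X.basicOpen h = E) (hEU : E ≤ U) (l' : Γ(L, E)) :
    ∃ (N : ℕ) (l : Γ(L, U)), secRes L hEU l = funRes hEU h ^ N • l' := by
  obtain ⟨t, ht, hspan⟩ := hL.exists_finset_trivializes hU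
  choose s hs using fun g : t => ht g.1 g.2
  let D (g : t) : X.Opens := X.basicOpen g.1
  have hD (g : t) : D g ≤ U := X.basicOpen_le g.1
  have hcover : U ≤ iSup D := hU.self_le_iSup_basicOpen_iff.2 hspan
  have basicOpen_funRes {W : X.Opens} (hW : W ≤ U) : X.basicOpen (funRes hW h) = W ⊓ E :=
    hE ▸ X.basicOpen_res h (homOfLE hW).op
  have extend (g : t) : ∀ᶠ N in Filter.atTop, ∃ l : Γ(L, D g), secRes L inf_le_left l =
      funRes inf_le_left (funRes (hD g) h) ^ N • secRes L (inf_le_right : D g ⊓ E ≤ E) l' :=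
    (hs g).eventually_exists_pow_smul (hU.basicOpen g.1) _ (basicOpen_funRes (hD g)) inf_le_left _
  obtain ⟨N, hN⟩ := (Filter.eventually_all.2 extend).exists
  choose l hl using hN
  obtain ⟨N', l₀, hl₀⟩ := exists_secRes_eq_pow_smul hD hcover h l fun g g' => by
    have affine_inter : IsAffineOpen (D g ⊓ D g') :=
      X.basicOpen_mul g.1 g'.1 ▸ hU.basicOpen (g.1 * g'.1)
    refine ((hs g).mono inf_le_left).eventually_pow_smul_eq affine_inter _ (basicOpen_funRes _)
      inf_le_left ?_
    have hg := congrArg (secRes L (inf_le_inf_right E inf_le_left :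
      (D g ⊓ D g') ⊓ E ≤ D g ⊓ E)) (hl g)
    have hg' := congrArg (secRes L (inf_le_inf_right E inf_le_right :
      (D g ⊓ D g') ⊓ E ≤ D g' ⊓ E)) (hl g')
    simp only [secRes_secRes, secRes_smul, map_pow, funRes_funRes] at hg hg' ⊢
    rw [hg, hg']
  refine ⟨N' + N, l₀, secRes_ext (fun g : t => D g ⊓ E) (fun _ => inf_le_right) ?_ fun g => ?_⟩
  · rw [← iSup_inf_eq]
    exact le_inf (hEU.trans hcover) le_rfl
  · have hg := congrArg (secRes L (inf_le_left : D g ⊓ E ≤ D g)) (hl₀ g)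
    rw [secRes_secRes, secRes_smul, hl] at hg
    rw [secRes_secRes, hg, secRes_smul]
    simp only [map_pow, funRes_funRes]
    rw [smul_smul, pow_add]

end IsLineBundle

end Sections

/-! ### Localization of `p^{-e}`-linear maps -/

section Localization

variable {p : ℕ} [Fact p.Prime] {A : Type*} [CommRing A] [InCharP p A] {e : ℕ}

section FrobMap

variable {M N : Type*} [AddCommGroup M] [Module A M] [AddCommGroup N] [Module A N]

/-- The pushforward `F^e_* f : F^e_* M → F^e_* N` of a linear map. -/
def frobMap (p e : ℕ) [Fact p.Prime] [InCharP p A] (f : M →ₗ[A] N) :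
    Frob p e M →ₗ[A] Frob p e N where
  toFun x := toFrob p e (f (ofFrob x))
  map_add' x y := map_add f (ofFrob x) (ofFrob y)
  map_smul' a x := map_smul f (a ^ p ^ e) (ofFrob x)

instance isLocalizedModule_frobMap (S : Submonoid A) (f : M →ₗ[A] N) [IsLocalizedModule S f] :
    IsLocalizedModule S (frobMap p e f) where
  map_units s := (Module.End.isUnit_iff _).2 <| by
    have bijective_smul : Function.Bijective fun x : N => ((s ^ p ^ e : S) : A) • x :=
      (Module.End.isUnit_iff _).1 (IsLocalizedModule.map_units f (s ^ p ^ e))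
    exact bijective_smul
  surj y := by
    obtain ⟨⟨x, s⟩, h⟩ := IsLocalizedModule.surj S f (ofFrob y)
    refine ⟨⟨toFrob p e ((s : A) ^ (p ^ e - 1) • x), s⟩, ?_⟩
    change (s : A) ^ p ^ e • ofFrob y = f ((s : A) ^ (p ^ e - 1) • x)
    rw [map_smul, ← pow_sub_one_mul (pow_ne_zero e (Fact.out : p.Prime).ne_zero), mul_smul]
    exact congrArg _ h
  exists_of_eq {x y} h := by
    obtain ⟨s, hs⟩ := IsLocalizedModule.exists_of_eq (S := S) (f := f) h
    refine ⟨s, ?_⟩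
    change (s ^ p ^ e) • ofFrob x = (s ^ p ^ e) • ofFrob y
    rw [← pow_sub_one_mul (pow_ne_zero e (Fact.out : p.Prime).ne_zero), mul_smul, mul_smul]
    exact congrArg _ hs

instance {B P : Type*} [CommRing B] [InCharP p B] [Algebra A B] [AddCommGroup P] [Module A P]
    [Module B P] [IsScalarTower A B P] : IsScalarTower A B (Frob p e P) where
  smul_assoc a b x := by
    change (a • b) ^ p ^ e • ofFrob x = a ^ p ^ e • b ^ p ^ e • ofFrob x
    rw [smul_pow, smul_assoc]

end FrobMap

namespace CartierMap

/-- A `p^{-e}`-linear map as a linear map out of the Frobenius pushforward. -/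
def toLinearMap {N : Type*} [AddCommGroup N] [Module A N] (θ : CartierMap p e A N) :
    Frob p e N →ₗ[A] A where
  toFun x := θ.toAddMonoidHom (ofFrob x)
  map_add' x y := map_add θ.toAddMonoidHom (ofFrob x) (ofFrob y)
  map_smul' a x := θ.map_smul' a (ofFrob x)

theorem exists_localization {B M N : Type*} [CommRing B] [InCharP p B] [Algebra A B]
    [AddCommGroup M] [Module A M] [AddCommGroup N] [Module A N] [Module B N] [IsScalarTower A B N]
    (S : Submonoid A) [IsLocalization S B] (f : M →ₗ[A] N) [IsLocalizedModule S f]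
    (θ : CartierMap p e A M) : ∃ θ' : CartierMap p e B N, ∀ x,
      θ'.toAddMonoidHom (f x) = algebraMap A B (θ.toAddMonoidHom x) := by
  let θ' : Frob p e N →ₗ[B] B :=
    IsLocalizedModule.mapExtendScalars S (frobMap p e f) (Algebra.linearMap A B) B θ.toLinearMap
  exact ⟨⟨θ'.toAddMonoidHom, fun b x => map_smul θ' b (toFrob p e x)⟩, fun x =>
    IsLocalizedModule.map_apply S (frobMap p e f) (Algebra.linearMap A B) θ.toLinearMap
      (toFrob p e x)⟩

omit [Fact p.Prime] [InCharP p A] in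
theorem exists_apply_one_eq_one (θ : CartierMap p 1 A A) (h : θ.toAddMonoidHom 1 = 1) (e : ℕ) :
    ∃ θ' : CartierMap p e A A, θ'.toAddMonoidHom 1 = 1 := by
  induction e with
  | zero => exact ⟨⟨AddMonoidHom.id A, fun s x => by simp⟩, rfl⟩
  | succ e ih =>
    obtain ⟨θ', h'⟩ := ih
    refine ⟨⟨θ.toAddMonoidHom.comp θ'.toAddMonoidHom, fun s x => ?_⟩,
      (congrArg θ.toAddMonoidHom h').trans h⟩
    have map_smul : θ'.toAddMonoidHom ((s ^ p ^ 1) ^ p ^ e • x) = s ^ p ^ 1 * θ'.toAddMonoidHom x :=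
      θ'.map_smul' _ x
    rw [← pow_mul, ← pow_add, add_comm 1 e] at map_smul
    exact (congrArg θ.toAddMonoidHom map_smul).trans (θ.map_smul' s _)

end CartierMap

end Localization

/-! ### The generic point -/

section Generic

variable {p : ℕ} [Fact p.Prime] {X V : Scheme.{u}}

theorem genericPoint_mem_basicOpen [IsIntegral V] {W : V.Opens} {a : Γ(V, W)} (ha : a ≠ 0) :
    genericPoint V ∈ V.basicOpen a :=
  (genericPoint_spec V).mem_open_set_iff (V.basicOpen a).2 |>.2 <| by
    simpa using (Opens.ne_bot_iff_nonempty _).1 fun h => ha ((basicOpen_eq_bot_iff a).1 h)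

theorem perfectGenericPoint_apply [IsIntegral V] [SchemeCharP p V]
    (y : Spec (.of (perfectFunctionField p V))) : perfectGenericPoint p V y = genericPoint V := by
  rw [perfectGenericPoint, Scheme.Hom.comp_apply,
    show Spec.map _ y = IsLocalRing.closedPoint V.functionField from
      Subsingleton.elim (α := PrimeSpectrum V.functionField) _ _]
  exact Scheme.fromSpecStalk_closedPoint

theorem Chart.evalAt_injective [IsIntegral V] {f : X ⟶ V} (c : Chart f) {K : Type u} [Field K]
    (u : Spec (.of K) ⟶ V) (hu : ⊤ ≤ u ⁻¹ᵁ c.W.1) (hgeneric : ∀ y, u y = genericPoint V) :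
    Function.Injective (c.evalAt u hu) := by
  refine (injective_iff_map_eq_zero _).2 fun a ha => by_contra fun hne => ?_
  have appLE_eq_zero : (u.appLE c.W.1 ⊤ hu).hom a = 0 :=
    (map_eq_zero_iff _ (Scheme.ΓSpecIso (.of K)).commRingCatIsoToRingEquiv.injective).1 ha
  have preimage_basicOpen := Scheme.basicOpen_appLE u ⊤ c.W.1 hu a
  rw [show (u.appLE c.W.1 ⊤ hu) a = 0 from appLE_eq_zero, Scheme.basicOpen_zero, top_inf_eq]
    at preimage_basicOpen
  let y : Spec (.of K) := (⊥ : PrimeSpectrum K)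
  have hy : y ∈ u ⁻¹ᵁ V.basicOpen (show Γ(V, c.W.1) from a) := by
    change u y ∈ V.basicOpen (show Γ(V, c.W.1) from a)
    exact hgeneric y ▸ genericPoint_mem_basicOpen hne
  rw [← preimage_basicOpen] at hy
  exact hy

theorem IsFPure.exists_apply_one_eq_one [SchemeCharP p V] (hpure : IsFPure p V) (e : ℕ) {v : V}
    {O : V.Opens} (hv : v ∈ O) : ∃ W : V.affineOpens, v ∈ W.1 ∧ W.1 ≤ O ∧
      ∃ θ : CartierMap p e Γ(V, W.1) Γ(V, W.1), θ.toAddMonoidHom 1 = 1 := by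
  obtain ⟨W, hW, θ, hθ⟩ := hpure v
  obtain ⟨g, hgO, hvg⟩ := W.2.exists_basicOpen_le ⟨v, hv⟩ hW
  obtain ⟨θe, hθe⟩ := θ.exists_apply_one_eq_one hθ e
  let : Algebra Γ(V, W.1) Γ(V, V.basicOpen g) := (funRes (V.basicOpen_le g)).toAlgebra
  have : IsLocalization.Away g Γ(V, V.basicOpen g) := isLocalization_funRes W.2 g rfl _
  obtain ⟨θ', hθ'⟩ := θe.exists_localization (B := Γ(V, V.basicOpen g)) (Submonoid.powers g)
    (Algebra.linearMap _ Γ(V, V.basicOpen g))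
  refine ⟨⟨V.basicOpen g, W.2.basicOpen g⟩, hvg, hgO, θ', ?_⟩
  simpa only [Algebra.linearMap_apply, map_one, hθe] using hθ' 1

theorem SheafCartierMap.Generates.exists_apply_eq_one [SchemeCharP p V] {e : ℕ}
    (hpure : IsFPure p V) {M : V.Modules} (hM : IsLineBundle M) {Ψ : SheafCartierMap p e V M}
    (hΨ : Ψ.Generates) (v : V) :
    ∃ W : V.affineOpens, v ∈ W.1 ∧ ∃ m : Γ(M, W.1), (Ψ.app W).toAddMonoidHom m = 1 := by
  obtain ⟨O, hO, s, hs⟩ := hM v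
  obtain ⟨W, hvW, hWO, θ, hθ⟩ := hpure.exists_apply_one_eq_one e hO
  let trivialization : Γ(V, W.1) ≃ₗ[Γ(V, W.1)] Γ(M, W.1) :=
    LinearEquiv.ofBijective (LinearMap.toSpanSingleton _ _ (secRes M hWO s)) (hs W.1 hWO)
  obtain ⟨a, ha⟩ := hΨ W ⟨θ.toAddMonoidHom.comp trivialization.symm.toLinearMap.toAddMonoidHom,
    fun r m => (congrArg θ.toAddMonoidHom (map_smul trivialization.symm _ m)).trans
      (θ.map_smul' r _)⟩
  refine ⟨W, hvW, a • trivialization 1, (ha _).symm.trans ?_⟩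
  change θ.toAddMonoidHom (trivialization.symm (trivialization 1)) = 1
  rw [trivialization.symm_apply_apply, hθ]

end Generic

/-! ### Stability of the images over a dense open set -/

section DenseOpen

variable {p e : ℕ} [Fact p.Prime] {X V : Scheme.{u}} {f : X ⟶ V}

/-- The chart `D(r) → W` cut out of a chart `U → W` by a function `r` on `U`. -/
def Chart.basicOpen (c : Chart f) (r : Γ(X, c.U.1)) : Chart f :=
  ⟨⟨X.basicOpen r, c.U.2.basicOpen r⟩, c.W, (X.basicOpen_le r).trans c.le⟩

namespace RelSheafCartierMap

variable [SchemeCharP p V] {L : X.Modules} {n : ℕ}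

theorem isGeneratingMap_res (φ : RelSheafCartierMap p e f L) (hL : IsLineBundle L)
    {c' c : Chart f} (hU : c'.U.1 ≤ c.U.1) (hW : c'.W.1 ≤ c.W.1) (r : Γ(X, c.U.1))
    (hr : X.basicOpen r = c'.U.1) :
    RelCartierMap.IsGeneratingMap (φ.app c) (φ.app c') (Chart.resA hW) (Chart.resR hU)
      (Chart.resR_comp hU hW) (Chart.resSec hU L) where
  smul r l := secRes_smul hU r l
  comp l := φ.app_res hU hW l
  generates l' := by
    change Γ(L, c'.U.1) at l'
    obtain ⟨N, l, hl⟩ := hL.exists_pow_smul_eq c.U.2 r hr hU l'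
    obtain ⟨v, hv⟩ := (isUnit_funRes_of_le_basicOpen r hU hr.ge).exists_left_inv
    refine AddSubmonoid.subset_closure
      ⟨v ^ N, 1, (r ^ (N * (p ^ e - 1)) • l : Γ(L, c.U.1)), ?_⟩
    rw [one_smul]
    change (v ^ N) ^ p ^ e • secRes L hU (r ^ (N * (p ^ e - 1)) • l) = l'
    have exponent_eq : N * (p ^ e - 1) + N = N * p ^ e := by
      rw [← Nat.mul_succ, Nat.succ_eq_add_one,
        Nat.sub_add_cancel (Nat.one_le_pow e p (Fact.out : p.Prime).pos)]
    rw [secRes_smul, hl, map_pow, smul_smul, smul_smul, mul_assoc, ← pow_add, exponent_eq,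
      ← pow_mul, ← mul_pow, hv, one_pow, one_smul]

theorem isStableAt_of_forall_exists_basicOpen (φ : RelSheafCartierMap p e f L)
    (hL : IsLineBundle L) {c : Chart f}
    (h : ∀ y ∈ c.U.1, ∃ r, y ∈ X.basicOpen r ∧ (φ.app (c.basicOpen r)).IsStableAt n) :
    (φ.app c).IsStableAt n := by
  refine RelCartierMap.isStableAt_of_forall_exists_pow
    (s := {r : Γ(X, c.U.1) | (φ.app (c.basicOpen r)).IsStableAt n}) ?_ fun r hr x hx => ?_
  · refine c.U.2.self_le_iSup_basicOpen_iff.1 fun y hy => ?_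
    obtain ⟨r, hyr, hr⟩ := h y hy
    exact Opens.mem_iSup.2 ⟨⟨r, hr⟩, hyr⟩
  · have bijective_resA :
        Function.Bijective (Chart.resA le_rfl : c.A →+* (c.basicOpen r).A) := by
      rw [show (Chart.resA le_rfl : c.A →+* (c.basicOpen r).A) = RingHom.id c.A from
        RingHom.ext fun a => funRes_self (U := c.W.1) a]
      exact Function.bijective_id
    exact (φ.isGeneratingMap_res hL (c' := c.basicOpen r) (X.basicOpen_le r) le_rfl r
      rfl).exists_pow_smul_mem bijective_resA r (isLocalization_funRes c.U.2 r rfl _) hr hx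

theorem IsUniformInteger.exists_mul_mem [IsIntegral V] [IsLocallyNoetherian V]
    [LocallyOfFiniteType f] {φ : RelSheafCartierMap p e f L} (hn : φ.IsUniformInteger n)
    (c : Chart f) (hc : genericPoint V ∈ c.W.1) :
    ∃ a : c.A, a ≠ 0 ∧ ∀ x ∈ ((φ.app c).image n).map
        (levelUp p c.A c.R (Nat.mul_le_mul_left e n.le_succ)),
      ((1 : c.R) ⊗ₜ[c.A] toRoot p (e * (n + 1)) a) * x ∈ (φ.app c).image (n + 1) := by
  have hu : ⊤ ≤ perfectGenericPoint p V ⁻¹ᵁ c.W.1 := fun y _ => by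
    change perfectGenericPoint p V y ∈ c.W.1
    rwa [perfectGenericPoint_apply]
  let : Algebra c.A (perfectFunctionField p V) :=
    (c.evalAt (perfectGenericPoint p V) hu).toAlgebra
  have : Nonempty c.W.1 := ⟨⟨_, hc⟩⟩
  have : IsDomain c.A := inferInstanceAs (IsDomain Γ(V, c.W.1))
  have : IsNoetherianRing c.A := IsLocallyNoetherian.component_noetherian c.W
  have : Algebra.FiniteType c.A c.R := f.finiteType_appLE c.W.2 c.U.2 c.le
  exact RelCartierMap.exists_mul_mem_of_isStableAt_baseChange
    (c.evalAt_injective _ hu perfectGenericPoint_apply)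
    ((RelCartierMap.isStableAt_iff_toAbsolute _ n).2 (hn c hu (n + 1) n.le_succ))

theorem IsUniformInteger.exists_isStableAt_of_le [IsIntegral V] [IsLocallyNoetherian V]
    [LocallyOfFiniteType f] {φ : RelSheafCartierMap p e f L} (hn : φ.IsUniformInteger n)
    (hL : IsLineBundle L) (c : Chart f) (hc : genericPoint V ∈ c.W.1) :
    ∃ a : Γ(V, c.W.1), a ≠ 0 ∧ ∀ c' : Chart f, c'.W.1 ≤ V.basicOpen a →
      (∃ r : Γ(X, c.U.1), X.basicOpen r = c'.U.1) → (φ.app c').IsStableAt n := by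
  obtain ⟨a, ha, hmul⟩ := hn.exists_mul_mem c hc
  refine ⟨a, ha, fun c' hW ⟨r, hr⟩ => ?_⟩
  exact (φ.isGeneratingMap_res hL (hr.ge.trans (X.basicOpen_le r)) (hW.trans (V.basicOpen_le _)) r
    hr).isStableAt_of_isUnit (isUnit_funRes_of_le_basicOpen (show Γ(V, c.W.1) from a) _ hW) hmul

theorem IsUniformInteger.exists_dense_isStableAt [IsIntegral V] [IsLocallyNoetherian V]
    [LocallyOfFiniteType f] [QuasiCompact f] {φ : RelSheafCartierMap p e f L}
    (hn : φ.IsUniformInteger n) (hL : IsLineBundle L) (W : V.affineOpens)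
    (hW : genericPoint V ∈ W.1) :
    ∃ U : V.Opens, U ≤ W.1 ∧ Dense (U : Set V) ∧
      ∀ c : Chart f, c.W.1 ≤ U → (φ.app c).IsStableAt n := by
  obtain ⟨t, ht, hcover⟩ := isCompact_and_isOpen_iff_finite_and_eq_biUnion_affineOpens.1
    ⟨f.isCompact_preimage W.2.isCompact, (f ⁻¹ᵁ W.1).2⟩
  have := ht.fintype
  let c (O : t) : Chart f := ⟨O.1, W, fun x hx => hcover.ge (Set.mem_biUnion O.2 hx)⟩
  choose a ha hstable using fun O : t => hn.exists_isStableAt_of_le hL (c O) hW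
  let b : Γ(V, W.1) := ∏ O, a O
  have hb : b ≠ 0 := by
    have : Nonempty W.1 := ⟨⟨_, hW⟩⟩
    exact Finset.prod_ne_zero_iff.2 fun O _ => ha O
  have basicOpen_le (O : t) : V.basicOpen b ≤ V.basicOpen (a O) := by
    obtain ⟨d, hd⟩ := Finset.dvd_prod_of_mem (show t → Γ(V, W.1) from a) (Finset.mem_univ O)
    rw [show b = a O * d from hd, V.basicOpen_mul]
    exact inf_le_left
  refine ⟨V.basicOpen b, V.basicOpen_le b,
    (V.basicOpen b).2.dense ⟨_, genericPoint_mem_basicOpen hb⟩, fun c' hc' => ?_⟩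
  refine φ.isStableAt_of_forall_exists_basicOpen hL fun y hy => ?_
  obtain ⟨O, hO, hyO⟩ := Set.mem_iUnion₂.1 (hcover.le (V.basicOpen_le b (hc' (c'.le hy))))
  obtain ⟨r, r₀, hr, hyr⟩ := exists_basicOpen_le_affine_inter c'.U.2 O.2 y ⟨hy, hyO⟩
  exact ⟨r, hyr, hstable ⟨O, hO⟩ (c'.basicOpen r) (hc'.trans (basicOpen_le ⟨O, hO⟩)) ⟨r₀, hr.symm⟩⟩

end RelSheafCartierMap

end DenseOpen

end RelFrob

end

open RelFrob in
theorem mainTheorem5_general (p : ℕ) [Fact p.Prime] (e : ℕ)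
    {X V : Scheme.{u}} [IsIntegral V] [IsLocallyNoetherian V] [SchemeCharP p V]
    (hpure : IsFPure p V) (f : X ⟶ V) [LocallyOfFiniteType f] [QuasiCompact f]
    (L : X.Modules) (hL : IsLineBundle L) (φ : RelSheafCartierMap p e f L)
    (M : V.Modules) (hM : IsLineBundle M) (Ψ : SheafCartierMap p e V M) (hΨ : Ψ.Generates)
    (n₀ : ℕ) (hn₀ : φ.IsUniformInteger n₀) (n : ℕ) (hn : n₀ ≤ n) :
    ∃ U : V.Opens, Dense (U : Set V) ∧
      (∀ c : Chart f, c.W.1 ≤ U → φ.sigmaGamma Ψ n c = φ.sigmaN n c) ∧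
      ∀ (K : Type u) [Field K] [PerfectField K] [CharP K p] (u : Spec (.of K) ⟶ V)
        (c : Chart f) (_ : c.W.1 ≤ U) (hu : ⊤ ≤ u ⁻¹ᵁ c.W.1),
        letI : Algebra c.A K := (c.evalAt u hu).toAlgebra
        (φ.sigmaGamma Ψ n c).map (baseRingMap p (e * n) c.A c.R K) =
            ((φ.app c).baseChange K).image n ∧
          ((φ.app c).baseChange K).image n =
            ((φ.app c).fiberMap K).sigma.map
              (algebraMap (K ⊗[c.A] c.R) ((K ⊗[c.A] c.R) ⊗[K] Root p (e * n) K)) := by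
  obtain ⟨W, hW, m, hm⟩ := hΨ.exists_apply_eq_one hpure hM (genericPoint V)
  obtain ⟨U, hUW, hdense, stable_n₀⟩ := hn₀.exists_dense_isStableAt hL W hW
  have stable (c : Chart f) (hc : c.W.1 ≤ U) : (φ.app c).IsStableAt n := (stable_n₀ c hc).of_le hn
  have sigma_eq (c : Chart f) (hc : c.W.1 ≤ U) : φ.sigmaGamma Ψ n c = φ.sigmaN n c := by
    have apply_secRes : (Ψ.app c.W).toAddMonoidHom (secRes M (hc.trans hUW) m) = 1 :=
      (Ψ.app_res (hc.trans hUW) m).trans (hm ▸ map_one (funRes (hc.trans hUW)))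
    exact (φ.app c).sigma_gamma_eq_image (Ψ.onChart c) (stable c hc) apply_secRes
  refine ⟨U, hdense, sigma_eq, fun K _ _ _ u c hc hu => ?_⟩
  let : Algebra c.A K := (c.evalAt u hu).toAlgebra
  have stable_fiber : ((φ.app c).baseChange K).IsStableAt n :=
    ((φ.app c).isGeneratingMap_baseChange K).isStableAt (stable c hc)
  exact ⟨sigma_eq c hc ▸ ((φ.app c).image_baseChange K n).symm,
    (RelCartierMap.map_sigma_toAbsolute _ stable_fiber).symm⟩

open RelFrob in
theorem mainTheorem5 (p : ℕ) [Fact p.Prime] (e : ℕ) (he : 0 < e)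
    {X V : Scheme.{u}} [IsIntegral V] [IsNoetherian V] [SchemeCharP p V]
    (hfin : IsFFinite p V) (hpure : IsFPure p V)
    (f : X ⟶ V) [LocallyOfFiniteType f] [QuasiCompact f]
    (L : X.Modules) (hL : IsLineBundle L) (φ : RelSheafCartierMap p e f L)
    (M : V.Modules) (hM : IsLineBundle M) (Ψ : SheafCartierMap p e V M) (hΨ : Ψ.Generates)
    (n₀ : ℕ) (hn₀ : φ.IsUniformInteger n₀) (n : ℕ) (hn : n₀ < n) :
    ∃ U : V.Opens, Dense (U : Set V) ∧
      (∀ c : Chart f, c.W.1 ≤ U → φ.sigmaGamma Ψ n c = φ.sigmaN n c) ∧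
      ∀ (K : Type u) [Field K] [PerfectField K] [CharP K p] (u : Spec (.of K) ⟶ V)
        (c : Chart f) (_ : c.W.1 ≤ U) (hu : ⊤ ≤ u ⁻¹ᵁ c.W.1),
        letI : Algebra c.A K := (c.evalAt u hu).toAlgebra
        (φ.sigmaGamma Ψ n c).map (baseRingMap p (e * n) c.A c.R K) =
            ((φ.app c).baseChange K).image n ∧
          ((φ.app c).baseChange K).image n =
            ((φ.app c).fiberMap K).sigma.map
              (algebraMap (K ⊗[c.A] c.R) ((K ⊗[c.A] c.R) ⊗[K] Root p (e * n) K)) := by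
  exact mainTheorem5_general p e hpure f L hL φ M hM Ψ hΨ n₀ hn₀ n hn.le
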